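/- For a connected finite simple graph $G$ let $d_G(u,v)$ be the distance of the vertices $u,v$ and $e_G(u)=\max_v d_G(u,v)$ the eccentricity of $u$. The eccentricity matrix $\mathcal{E}(G)$ is the real symmetric matrix indexed by the vertices of $G$ whose $(u,v)$ entry is $d_G(u,v)$ if $d_G(u,v)=\min\{e_G(u),e_G(v)\}$ and $0$ otherwise, and the $\mathcal{E}$-energy $E_{\mathcal{E}}(G)$ is the sum of the absolute values of the eigenvalues of $\mathcal{E}(G)$, counted with multiplicity. For $n\ge 4$ let $T_{n,3}^{0,n-4}$ be the tree on $n$ vertices obtained from the path $v_0v_1v_2v_3$ by attaching $n-4$ pendant vertices to $v_2$. **Theorem.** Let $T$ be a tree of order $n\ge 4$ whose complement $T^c$ is connected (equivalently, $T$ is not a star). Then $$E_{\mathcal{E}}(T)+E_{\mathcal{E}}(T^c)\ \ge\ 2\Big(\sqrt{13n-35+8\sqrt{n-3}}+\sqrt{4n+1+8\sqrt{n-3}}\Big),$$ with equality if and only if $T\cong T_{n,3}^{0,n-4}$. -/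

import Mathlib

namespace SimpleGraph

open Classical in
/-- The eccentricity matrix of a graph `G`: the `(u, v)` entry is the distance of `u` and `v` when
that distance equals the smaller of the eccentricities of `u` and `v`, and `0` otherwise.
(It is meant for connected graphs, where all the eccentricities are finite.) -/
noncomputable def eccMatrix {V : Type*} (G : SimpleGraph V) : Matrix V V ℝ :=
  Matrix.of fun u v =>
    if (G.dist u v : ℕ∞) = min (G.eccent u) (G.eccent v) then (G.dist u v : ℝ) else 0

theorem eccMatrix_isHermitian {V : Type*} (G : SimpleGraph V) : G.eccMatrix.IsHermitian := by
  ext u v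
  simp only [eccMatrix, Matrix.conjTranspose_apply, Matrix.of_apply, star_trivial]
  rw [G.dist_comm, min_comm]

/-- The eccentricity energy of a finite graph: the sum of the absolute values of the eigenvalues,
listed with multiplicity, of its eccentricity matrix. -/
noncomputable def eccEnergy {V : Type*} [Fintype V] [DecidableEq V] (G : SimpleGraph V) : ℝ :=
  ∑ i, |G.eccMatrix_isHermitian.eigenvalues i|

/-- The tree obtained from the path `v₀ v₁ v₂ v₃` by attaching `a` pendant vertices to `v₁` and
`b` pendant vertices to `v₂`. -/
def diamThreeTree (a b : ℕ) : SimpleGraph (Fin 4 ⊕ (Fin a ⊕ Fin b)) :=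
  SimpleGraph.fromRel fun x y =>
    match x, y with
    | Sum.inl i, Sum.inl j => (SimpleGraph.pathGraph 4).Adj i j
    | Sum.inl i, Sum.inr (Sum.inl _) => i = 1
    | Sum.inl i, Sum.inr (Sum.inr _) => i = 2
    | _, _ => False

end SimpleGraph

/-! The energy is the trace norm of the eccentricity matrix. In a tree with diametral pair `x`, `y`
every eccentricity is attained at `x` or at `y` (`dist_le_max_of_diametral`), so the matrix can be
read off from distances. A vertex adjacent to all others would be isolated in the complement, so the
diameter is at least three.

Diameter three means a double star with `a` and `b` leaves at its centres. Both eccentricity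
matrices are blow-ups of the path on four vertices with edge weights 2, 3, 2: the class sizes are 1,
`a`, `b`, 1 for the tree and `a`, 1, 1, `b` for the complement. The quotient has characteristic
polynomial X⁴ - cX² + π², so `traceNorm_blowup_weightedPath` gives both energies in closed form. For
fixed a + b = n - 2 both increase with ab, and ab - (n - 3) = (a - 1)(b - 1), which yields the bound
and the equality case.

For diameter at least four the inequality is strict. Two tools bound trace norms from below: ‖M‖₁² ≥
2‖M‖_F² - (tr M)², and pinching, by which the compressions to two complementary orthogonal subspaces
have trace norms of sum at most ‖M‖₁. The complement has entry 2 at each of the n - 1 edges of the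
tree, so its energy is at least 4√(n - 1). For the tree itself the Frobenius bound is applied after
a pinching: for diameter at least five along a splitting of the vertices into stars centred at `x`
and `y`, for diameter four along the symmetric and antisymmetric vectors of the reflection of a
diametral path. Elementary estimates of square roots finish the proof. -/

/-! ### Trace norm: moments, Frobenius bound, duality. -/

namespace Matrix.IsHermitian

variable {V : Type*} [Fintype V] [DecidableEq V] {M : Matrix V V ℝ}

/-- The sum of the absolute values of the eigenvalues of a real symmetric matrix. -/
noncomputable def traceNorm (hM : M.IsHermitian) : ℝ := ∑ i, |hM.eigenvalues i|

theorem exists_orthogonal_diagonalization (hM : M.IsHermitian) :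
    ∃ U : Matrix V V ℝ, Uᵀ * U = 1 ∧ U * Uᵀ = 1 ∧ M = U * diagonal hM.eigenvalues * Uᵀ := by
  refine ⟨hM.eigenvectorUnitary, ?_, ?_, ?_⟩
  · have := Unitary.coe_star_mul_self hM.eigenvectorUnitary
    simpa [star_eq_conjTranspose] using this
  · have := Unitary.coe_mul_star_self hM.eigenvectorUnitary
    simpa [star_eq_conjTranspose] using this
  · have := hM.spectral_theorem
    simpa [Unitary.conjStarAlgAut_apply, star_eq_conjTranspose, Function.comp_def] using this

theorem trace_pow_eq_sum (hM : M.IsHermitian) (k : ℕ) :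
    (M ^ k).trace = ∑ i, hM.eigenvalues i ^ k := by
  obtain ⟨U, h1, -, h3⟩ := hM.exists_orthogonal_diagonalization
  have key : ∀ k, M ^ k * U = U * (diagonal hM.eigenvalues) ^ k := by
    intro k
    induction k with
    | zero => simp
    | succ k ih =>
      have hMU : M * U = U * diagonal hM.eigenvalues := by
        conv_lhs => rw [h3, Matrix.mul_assoc, h1, Matrix.mul_one]
      rw [pow_succ, Matrix.mul_assoc, hMU, ← Matrix.mul_assoc, ih, Matrix.mul_assoc, ← pow_succ]
  have h2 : U * Uᵀ = 1 := mul_eq_one_comm.mp h1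
  have : M ^ k = U * (diagonal hM.eigenvalues) ^ k * Uᵀ := by
    rw [← key, Matrix.mul_assoc, h2, Matrix.mul_one]
  rw [this, Matrix.trace_mul_comm, ← Matrix.mul_assoc, h1, Matrix.one_mul, diagonal_pow,
    trace_diagonal]
  simp

theorem trace_sq_eq_sum_sq (hM : M.IsHermitian) : (M ^ 2).trace = ∑ u, ∑ v, M u v ^ 2 := by
  simp only [sq, trace, diag, mul_apply]
  refine Finset.sum_congr rfl fun u _ => Finset.sum_congr rfl fun v _ => ?_
  have := hM.apply u v
  simp only [star_trivial] at this
  rw [this]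

/-- The trace norm is at least the root of twice the square of the Frobenius norm minus the
square of the trace. -/
theorem two_mul_sum_sq_sub_trace_sq_le (hM : M.IsHermitian) :
    2 * (∑ u, ∑ v, M u v ^ 2) - M.trace ^ 2 ≤ hM.traceNorm ^ 2 := by
  have h2 := hM.trace_pow_eq_sum 2
  have h1 := hM.trace_pow_eq_sum 1
  rw [hM.trace_sq_eq_sum_sq] at h2
  simp only [pow_one] at h1
  rw [h1, h2, traceNorm]
  set l := hM.eigenvalues
  have e1 : (∑ i, |l i|) ^ 2 = ∑ i, l i ^ 2 + ∑ i, ∑ j ∈ Finset.univ.erase i, |l i| * |l j| := by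
    rw [sq, Finset.sum_mul_sum, ← Finset.sum_add_distrib]
    refine Finset.sum_congr rfl fun i _ => ?_
    rw [← Finset.add_sum_erase _ _ (Finset.mem_univ i), abs_mul_abs_self, sq]
  have e2 : (∑ i, l i) ^ 2 = ∑ i, l i ^ 2 + ∑ i, ∑ j ∈ Finset.univ.erase i, l i * l j := by
    rw [sq, Finset.sum_mul_sum, ← Finset.sum_add_distrib]
    refine Finset.sum_congr rfl fun i _ => ?_
    rw [← Finset.add_sum_erase _ _ (Finset.mem_univ i), sq]
  -- The only loss is in the cross terms, and there is none when distinct nonzero eigenvalues always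
  -- have opposite signs, as for a star.
  have e3 : -(∑ i, ∑ j ∈ Finset.univ.erase i, l i * l j)
      ≤ ∑ i, ∑ j ∈ Finset.univ.erase i, |l i| * |l j| := by
    rw [← Finset.sum_neg_distrib]
    refine Finset.sum_le_sum fun i _ => ?_
    rw [← Finset.sum_neg_distrib]
    refine Finset.sum_le_sum fun j _ => ?_
    rw [← abs_mul]
    exact neg_le_abs _
  linarith

theorem traceNorm_nonneg (hM : M.IsHermitian) : 0 ≤ hM.traceNorm :=
  Finset.sum_nonneg fun _ _ => abs_nonneg _

theorem sqrt_le_traceNorm (hM : M.IsHermitian) {f t : ℝ} (hf : f ≤ ∑ u, ∑ v, M u v ^ 2)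
    (ht : M.trace ^ 2 ≤ t ^ 2) : √(2 * f - t ^ 2) ≤ hM.traceNorm := by
  refine Real.sqrt_le_iff.mpr ⟨hM.traceNorm_nonneg, ?_⟩
  linarith [hM.two_mul_sum_sq_sub_trace_sq_le]

/-- The witness is the sign of `M` in an eigenbasis, with the sign of 0 taken to be 1 so that it
squares to the identity. With `trace_mul_le_traceNorm` this is the duality behind pinching. -/
theorem exists_involution_trace_mul_eq (hM : M.IsHermitian) :
    ∃ X : Matrix V V ℝ, Xᵀ = X ∧ X * X = 1 ∧ (M * X).trace = hM.traceNorm := by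
  obtain ⟨U, h1, h2, h3⟩ := hM.exists_orthogonal_diagonalization
  set l := hM.eigenvalues
  let s : V → ℝ := fun i => if 0 ≤ l i then 1 else -1
  refine ⟨U * diagonal s * Uᵀ, ?_, ?_, ?_⟩
  · simp [Matrix.mul_assoc]
  · have hs : diagonal s * diagonal s = (1 : Matrix V V ℝ) := by
      rw [diagonal_mul_diagonal, ← diagonal_one]
      congr 1
      ext i
      simp only [s]
      split_ifs <;> norm_num
    calc U * diagonal s * Uᵀ * (U * diagonal s * Uᵀ)
        = U * diagonal s * (Uᵀ * U) * diagonal s * Uᵀ := by simp only [Matrix.mul_assoc]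
      _ = U * (diagonal s * diagonal s) * Uᵀ := by
        rw [h1]
        simp only [Matrix.mul_assoc, Matrix.one_mul]
      _ = 1 := by rw [hs, Matrix.mul_one, h2]
  · have : M * (U * diagonal s * Uᵀ) = U * (diagonal l * diagonal s) * Uᵀ := by
      calc M * (U * diagonal s * Uᵀ)
          = U * diagonal l * (Uᵀ * U) * diagonal s * Uᵀ := by
            conv_lhs => rw [h3]
            simp only [Matrix.mul_assoc]
        _ = _ := by rw [h1]; simp only [Matrix.mul_assoc, Matrix.one_mul]
    rw [this, Matrix.trace_mul_comm, ← Matrix.mul_assoc, h1, Matrix.one_mul,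
      diagonal_mul_diagonal, trace_diagonal]
    refine Finset.sum_congr rfl fun i _ => ?_
    simp only [s]
    split_ifs with h
    · rw [mul_one, abs_of_nonneg h]
    · rw [mul_neg_one, abs_of_neg (not_le.mp h)]

/-- In an eigenbasis of `M` the trace is a combination of the eigenvalues whose coefficients are
diagonal entries of `X`, of modulus at most 1. A bound on the quadratic form suffices, which is easy
to check for sums of blocks. -/
theorem trace_mul_le_traceNorm (hM : M.IsHermitian) {X : Matrix V V ℝ}
    (hX : ∀ u : V → ℝ, |u ⬝ᵥ X *ᵥ u| ≤ u ⬝ᵥ u) : (M * X).trace ≤ hM.traceNorm := by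
  obtain ⟨U, h1, h2, h3⟩ := hM.exists_orthogonal_diagonalization
  set l := hM.eigenvalues with hl
  have e : (M * X).trace = ∑ i, l i * (Uᵀ * X * U) i i := by
    have : (M * X).trace = (diagonal l * (Uᵀ * X * U)).trace := by
      conv_lhs => rw [h3]
      rw [Matrix.mul_assoc, Matrix.mul_assoc, Matrix.trace_mul_comm]
      simp only [Matrix.mul_assoc]
    rw [this]
    simp [trace, diagonal_mul]
  rw [e, traceNorm]
  refine Finset.sum_le_sum fun i _ => ?_
  have hi : (Uᵀ * X * U) i i = (fun j => U j i) ⬝ᵥ X *ᵥ (fun j => U j i) := by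
    rw [Matrix.mul_assoc]
    simp [Matrix.mul_apply, dotProduct, mulVec]
  have hn : (fun j => U j i) ⬝ᵥ (fun j => U j i) = 1 := by
    have := congrFun (congrFun h1 i) i
    simpa [Matrix.mul_apply, dotProduct] using this
  have := hX fun j => U j i
  rw [hn, ← hi] at this
  calc l i * (Uᵀ * X * U) i i ≤ |l i * (Uᵀ * X * U) i i| := le_abs_self _
    _ = |l i| * |(Uᵀ * X * U) i i| := abs_mul _ _
    _ ≤ |l i| * 1 := by gcongr
    _ = |l i| := mul_one _

end Matrix.IsHermitian

/-! ### Pinching, and trace norms from a quartic equation. -/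

namespace Matrix

variable {V : Type*} [Fintype V] {M : Matrix V V ℝ}

theorem abs_dotProduct_mulVec_le_of_involution [DecidableEq V] {X : Matrix V V ℝ} (hs : Xᵀ = X) (h2 : X * X = 1)
    (u : V → ℝ) : |u ⬝ᵥ X *ᵥ u| ≤ u ⬝ᵥ u := by
  have hn : (X *ᵥ u) ⬝ᵥ (X *ᵥ u) = u ⬝ᵥ u := by
    rw [dotProduct_mulVec, ← mulVec_transpose, hs, mulVec_mulVec, h2, one_mulVec]
  have hp : 0 ≤ (u + X *ᵥ u) ⬝ᵥ (u + X *ᵥ u) := by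
    simpa using dotProduct_star_self_nonneg (u + X *ᵥ u)
  have hm : 0 ≤ (u - X *ᵥ u) ⬝ᵥ (u - X *ᵥ u) := by
    simpa using dotProduct_star_self_nonneg (u - X *ᵥ u)
  have hc : (X *ᵥ u) ⬝ᵥ u = u ⬝ᵥ X *ᵥ u := dotProduct_comm _ _
  simp only [add_dotProduct, dotProduct_add, sub_dotProduct, dotProduct_sub, hn, hc] at hp hm
  rw [abs_le]
  constructor <;> linarith

theorem IsHermitian.compression (hM : M.IsHermitian) {P : Matrix V V ℝ} (hP : P.IsHermitian) :
    (P * M * P).IsHermitian := by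
  have := isHermitian_conjTranspose_mul_mul P hM
  rwa [hP.eq] at this

/-- Pinching: the trace norms of the compressions to two complementary orthogonal subspaces add up
to at most the trace norm. -/
theorem IsHermitian.traceNorm_compression_add_le [DecidableEq V] (hM : M.IsHermitian) {P Q : Matrix V V ℝ}
    (hP : P.IsHermitian) (hQ : Q.IsHermitian) (hPP : P * P = P) (hQQ : Q * Q = Q)
    (hPQ : P + Q = 1) :
    (hM.compression hP).traceNorm + (hM.compression hQ).traceNorm ≤ hM.traceNorm := by
  obtain ⟨X, hXs, hX2, hX⟩ := (hM.compression hP).exists_involution_trace_mul_eq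
  obtain ⟨Y, hYs, hY2, hY⟩ := (hM.compression hQ).exists_involution_trace_mul_eq
  rw [← hX, ← hY]
  have ht : ∀ R Z : Matrix V V ℝ, (R * M * R * Z).trace = (M * (R * Z * R)).trace := by
    intro R Z
    rw [Matrix.mul_assoc, Matrix.mul_assoc, Matrix.trace_mul_comm]
    simp only [Matrix.mul_assoc]
  -- The two sign matrices glue to the test matrix P X P + Q Y Q, whose quadratic form is bounded by
  -- |Pu|² + |Qu|² = |u|².
  rw [ht, ht, ← trace_add, ← Matrix.mul_add]
  refine hM.trace_mul_le_traceNorm fun u => ?_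
  have hq : ∀ {R Z : Matrix V V ℝ}, R.IsHermitian →
      u ⬝ᵥ (R * Z * R) *ᵥ u = (R *ᵥ u) ⬝ᵥ Z *ᵥ (R *ᵥ u) := by
    intro R Z hR
    have hR' : Rᵀ = R := by simpa [IsHermitian] using hR
    rw [Matrix.mul_assoc, ← mulVec_mulVec, dotProduct_mulVec, ← mulVec_transpose, hR',
      ← mulVec_mulVec]
  have hn : ∀ {R : Matrix V V ℝ}, R.IsHermitian → R * R = R →
      (R *ᵥ u) ⬝ᵥ (R *ᵥ u) = u ⬝ᵥ R *ᵥ u := by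
    intro R hR hRR
    have := hq (Z := 1) hR
    rw [one_mulVec, Matrix.mul_one, hRR] at this
    exact this.symm
  rw [add_mulVec, dotProduct_add, hq hP, hq hQ]
  calc _ ≤ |(P *ᵥ u) ⬝ᵥ X *ᵥ (P *ᵥ u)| + |(Q *ᵥ u) ⬝ᵥ Y *ᵥ (Q *ᵥ u)| := abs_add_le _ _
    _ ≤ (P *ᵥ u) ⬝ᵥ (P *ᵥ u) + (Q *ᵥ u) ⬝ᵥ (Q *ᵥ u) :=
        add_le_add (abs_dotProduct_mulVec_le_of_involution hXs hX2 _)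
          (abs_dotProduct_mulVec_le_of_involution hYs hY2 _)
    _ = u ⬝ᵥ u := by
        rw [hn hP hPP, hn hQ hQQ, ← dotProduct_add, ← add_mulVec, hPQ, one_mulVec]

/-- The trace norm of a symmetric matrix whose eigenvalues are `0` and the roots of
`X⁴ - c X² + π²`, each nonzero one counted once. -/
theorem IsHermitian.traceNorm_eq_two_mul_sqrt [DecidableEq V] (hM : M.IsHermitian) {c p : ℝ} (hp : 0 < p)
    (hc : 0 < c) (h : M ^ 5 + p ^ 2 • M = c • M ^ 3) (h2 : (M ^ 2).trace = 2 * c)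
    (h4 : (M ^ 4).trace = 2 * (c ^ 2 - 2 * p ^ 2)) : hM.traceNorm = 2 * √(c + 2 * p) := by
  set s := √(c + 2 * p) with hs
  have hs0 : 0 < s := Real.sqrt_pos.mpr (by linarith)
  have hs2 : s ^ 2 = c + 2 * p := Real.sq_sqrt (by linarith)
  -- A nonzero root of the quartic satisfies (a² + p)² = (c + 2p)a², hence a² + p = s|a|. This makes
  -- |a| a fixed combination of a² and a⁴, valid also at a = 0, so the second and fourth moments
  -- determine the trace norm.
  have key : ∀ i, |hM.eigenvalues i|
      = (s ^ 2 - p) / (s * p) * hM.eigenvalues i ^ 2 - 1 / (s * p) * hM.eigenvalues i ^ 4 := by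
    intro i
    have hev := hM.mulVec_eigenvectorBasis i
    set w : V → ℝ := ⇑(hM.eigenvectorBasis i) with hw
    set a := hM.eigenvalues i
    have hw0 : w ≠ 0 := by
      intro h0
      have := hM.eigenvectorBasis.orthonormal.ne_zero i
      exact this (by ext j; simpa [hw] using congrFun h0 j)
    have hpow : ∀ k : ℕ, (M ^ k) *ᵥ w = a ^ k • w := by
      intro k
      induction k with
      | zero => simp
      | succ k ih => rw [pow_succ', ← mulVec_mulVec, ih, mulVec_smul, hev, smul_smul, ← pow_succ]
    have h' : a ^ 5 + p ^ 2 * a = c * a ^ 3 := by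
      have := congrArg (· *ᵥ w) h
      simp only [add_mulVec, smul_mulVec, hpow, hev, smul_smul, ← add_smul] at this
      exact smul_left_injective ℝ hw0 this
    rcases eq_or_ne a 0 with h0 | h0
    · simp [h0]
    have ha : 0 < |a| := abs_pos.mpr h0
    have h'' : a ^ 4 + p ^ 2 = c * a ^ 2 := by
      apply mul_left_cancel₀ h0
      linear_combination h'
    have h3 : |a| ^ 2 = a ^ 2 := sq_abs a
    have h5 : (|a| ^ 2 + p) ^ 2 = (s * |a|) ^ 2 := by
      rw [mul_pow, hs2, h3]
      linear_combination h''
    have h6 : |a| ^ 2 + p = s * |a| := by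
      have := (sq_eq_sq₀ (by positivity) (by positivity)).mp h5
      exact this
    rw [← h3, show a ^ 4 = |a| ^ 4 by rw [show (4 : ℕ) = 2 * 2 from rfl, pow_mul, pow_mul, h3]]
    field_simp
    have h7 : p = s * |a| - |a| ^ 2 := by linarith
    rw [h7]
    ring
  rw [traceNorm, Finset.sum_congr rfl fun i _ => key i, Finset.sum_sub_distrib, ← Finset.mul_sum,
    ← Finset.mul_sum, ← hM.trace_pow_eq_sum, ← hM.trace_pow_eq_sum, h2, h4]
  have hcs : c = s ^ 2 - 2 * p := by linarith
  rw [hcs]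
  field_simp
  ring

end Matrix

/-! ### Blow-ups of the weighted path on four vertices. -/

namespace Matrix

/-- The weighted adjacency matrix of a path on four vertices. -/
def weightedPath (α β γ : ℝ) : Matrix (Fin 4) (Fin 4) ℝ :=
  !![0, α, 0, 0; α, 0, β, 0; 0, β, 0, γ; 0, 0, γ, 0]

variable {V : Type*} [Fintype V]

/-- Summing over the middle vertex class by class gives each class its size as weight. Powers of a
blow-up thus reduce to products of small matrices. -/
theorem submatrix_mul_submatrix_fiber {ι : Type*} [Fintype ι] [DecidableEq ι] (t : V → ι)
    {N : ι → ℝ} (hN : ∀ i, (Fintype.card {v // t v = i} : ℝ) = N i) (K L : Matrix ι ι ℝ) :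
    K.submatrix t t * L.submatrix t t = (K * diagonal N * L).submatrix t t := by
  ext u v
  rw [mul_apply, submatrix_apply, mul_apply]
  simp only [mul_diagonal, submatrix_apply]
  rw [← Finset.sum_fiberwise (s := Finset.univ) (g := t)]
  refine Finset.sum_congr rfl fun i _ => ?_
  rw [← hN, Fintype.card_subtype, Finset.sum_congr rfl (g := fun _ => K (t u) i * L i (t v))]
  · rw [Finset.sum_const, nsmul_eq_mul]
    ring
  · intro w hw
    rw [(Finset.mem_filter.mp hw).2]

theorem trace_submatrix_fiber {ι : Type*} [Fintype ι] [DecidableEq ι] (t : V → ι)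
    {N : ι → ℝ} (hN : ∀ i, (Fintype.card {v // t v = i} : ℝ) = N i) (K : Matrix ι ι ℝ) :
    (K.submatrix t t).trace = ∑ i, N i * K i i := by
  simp only [trace, diag, submatrix_apply]
  rw [← Finset.sum_fiberwise (s := Finset.univ) (g := t)]
  refine Finset.sum_congr rfl fun i _ => ?_
  rw [← hN, Fintype.card_subtype, Finset.sum_congr rfl (g := fun _ => K i i)]
  · rw [Finset.sum_const, nsmul_eq_mul]
  · intro w hw
    rw [(Finset.mem_filter.mp hw).2]

/-- The trace norm of a blow-up of a weighted path on four vertices. -/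
theorem IsHermitian.traceNorm_blowup_weightedPath [DecidableEq V] {M : Matrix V V ℝ} (hM : M.IsHermitian)
    {α β γ N₀ N₁ N₂ N₃ : ℝ} (t : V → Fin 4) (ht : M = (weightedPath α β γ).submatrix t t)
    (hN : ∀ i, (Fintype.card {v // t v = i} : ℝ) = ![N₀, N₁, N₂, N₃] i)
    (hα : 0 < α) (hβ : 0 < β) (hγ : 0 < γ)
    (h0 : 0 < N₀) (h1 : 0 < N₁) (h2 : 0 < N₂) (h3 : 0 < N₃) :
    hM.traceNorm = 2 * √(α ^ 2 * (N₀ * N₁) + β ^ 2 * (N₁ * N₂) + γ ^ 2 * (N₂ * N₃)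
      + 2 * (α * γ * √(N₀ * N₁ * N₂ * N₃))) := by
  have hp : (α * γ * √(N₀ * N₁ * N₂ * N₃)) ^ 2 = α ^ 2 * γ ^ 2 * (N₀ * N₁ * N₂ * N₃) := by
    rw [mul_pow, Real.sq_sqrt (by positivity)]
    ring
  set W := weightedPath α β γ with hW
  set D := diagonal ![N₀, N₁, N₂, N₃] with hD
  set G : Matrix (Fin 4) (Fin 4) ℝ :=
    !![0, α * N₁, 0, 0; α * N₀, 0, β * N₂, 0; 0, β * N₁, 0, γ * N₃; 0, 0, γ * N₂, 0] with hG
  set H : Matrix (Fin 4) (Fin 4) ℝ :=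
    !![α ^ 2 * N₀ * N₁, 0, α * β * N₁ * N₂, 0;
       0, α ^ 2 * N₀ * N₁ + β ^ 2 * N₁ * N₂, 0, β * γ * N₂ * N₃;
       α * β * N₀ * N₁, 0, β ^ 2 * N₁ * N₂ + γ ^ 2 * N₂ * N₃, 0;
       0, β * γ * N₁ * N₂, 0, γ ^ 2 * N₂ * N₃] with hH
  have hWD : W * D = G := by
    ext i j
    rw [hD, mul_diagonal, hW, hG]
    fin_cases i <;> fin_cases j <;> simp [weightedPath]
  have hGG : G * G = H := by
    ext i j
    rw [mul_apply, Fin.sum_univ_four, hG, hH]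
    fin_cases i <;> fin_cases j <;> simp <;> ring
  -- Cayley–Hamilton for the quotient matrix `G`, whose characteristic polynomial is even, written
  -- in terms of `H` = `G`².
  have hHH : H * H + (α ^ 2 * γ ^ 2 * (N₀ * N₁ * N₂ * N₃)) • (1 : Matrix (Fin 4) (Fin 4) ℝ)
      = (α ^ 2 * (N₀ * N₁) + β ^ 2 * (N₁ * N₂) + γ ^ 2 * (N₂ * N₃)) • H := by
    ext i j
    rw [add_apply, mul_apply, Fin.sum_univ_four, smul_apply, smul_apply, hH]
    fin_cases i <;> fin_cases j <;> simp <;> ring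
  have e2 : M ^ 2 = (G * W).submatrix t t := by
    rw [sq, ht, submatrix_mul_submatrix_fiber t hN, hWD]
  have e3 : M ^ 3 = (H * W).submatrix t t := by
    rw [pow_succ, e2, ht, submatrix_mul_submatrix_fiber t hN, Matrix.mul_assoc G, hWD, hGG]
  have e4 : M ^ 4 = (H * G * W).submatrix t t := by
    rw [pow_succ, e3, ht, submatrix_mul_submatrix_fiber t hN, Matrix.mul_assoc H, hWD]
  have e5 : M ^ 5 = (H * H * W).submatrix t t := by
    rw [pow_succ, e4, ht, submatrix_mul_submatrix_fiber t hN, Matrix.mul_assoc (H * G), hWD,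
      Matrix.mul_assoc H, hGG]
  refine hM.traceNorm_eq_two_mul_sqrt (by positivity) (by positivity) ?_ ?_ ?_
  · have key := congrArg (· * W) hHH
    simp only [Matrix.add_mul, smul_mul, Matrix.one_mul] at key
    rw [hp, e5, e3, ht]
    ext u v
    exact congrFun (congrFun key (t u)) (t v)
  · rw [e2, trace_submatrix_fiber t hN, Fin.sum_univ_four]
    simp only [mul_apply, Fin.sum_univ_four, hG, hW]
    simp [weightedPath]
    ring
  · rw [hp, e4, trace_submatrix_fiber t hN, Fin.sum_univ_four, Matrix.mul_assoc]
    have hGW : G * W = !![α ^ 2 * N₁, 0, α * β * N₁, 0;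
        0, α ^ 2 * N₀ + β ^ 2 * N₂, 0, β * γ * N₂;
        α * β * N₁, 0, β ^ 2 * N₁ + γ ^ 2 * N₃, 0; 0, β * γ * N₂, 0, γ ^ 2 * N₂] := by
      ext i j
      rw [mul_apply, Fin.sum_univ_four, hG, hW]
      fin_cases i <;> fin_cases j <;> simp [weightedPath] <;> ring
    rw [hGW]
    simp only [mul_apply, Fin.sum_univ_four, hH]
    simp
    ring

end Matrix

/-! ### Distances in trees: medians, betweenness, diametral pairs. -/

namespace SimpleGraph

variable {V : Type*} {T : SimpleGraph V}

theorem IsTree.length_eq_dist_of_isPath (hT : T.IsTree) {u v : V} {p : T.Walk u v}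
    (hp : p.IsPath) : p.length = T.dist u v := by
  obtain ⟨q, hq, hl⟩ := hT.connected.exists_path_of_dist u v
  rw [(hT.existsUnique_path u v).unique hp hq, hl]

/-- Distances across an edge of a tree add up. -/
theorem IsTree.dist_eq_of_separating_adj (hT : T.IsTree) {r s a b : V} (hab : T.Adj a b)
    (hr : T.dist r b = T.dist r a + 1) (hs : T.dist a s = T.dist b s + 1) :
    T.dist r s = T.dist r a + 1 + T.dist b s := by
  obtain ⟨p, hp, hpl⟩ := hT.connected.exists_path_of_dist r a
  obtain ⟨q, hq, hql⟩ := hT.connected.exists_path_of_dist b s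
  have mem_dist : ∀ {u v z : V} {w : T.Walk u v}, w.length = T.dist u v → z ∈ w.support →
      T.dist u z + T.dist z v = T.dist u v := by
    classical
    intro u v z w hw hz
    have h1 := T.dist_le (w.takeUntil z hz)
    have h2 := T.dist_le (w.dropUntil z hz)
    have h3 := congrArg Walk.length (w.take_spec hz)
    rw [Walk.length_append] at h3
    have := hT.connected.dist_triangle (u := u) (v := z) (w := v)
    omega
  -- A common vertex would be strictly closer to `a` than to `b` and also strictly closer to `b`
  -- than to `a`.
  have hdisj : ∀ z, z ∈ p.support → z ∉ q.support := by
    intro z hzp hzq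
    have h1 := mem_dist hpl hzp
    have h2 := mem_dist hql hzq
    have h3 := hT.connected.dist_triangle (u := r) (v := z) (w := b)
    have h4 := hT.connected.dist_triangle (u := a) (v := z) (w := s)
    rw [T.dist_comm (u := z) (v := b)] at h3
    rw [T.dist_comm (u := a) (v := z)] at h4
    omega
  have hpath : (p.append (Walk.cons hab q)).IsPath := by
    rw [Walk.isPath_def, Walk.support_append, Walk.support_cons, List.tail_cons,
      List.nodup_append]
    refine ⟨hp.support_nodup, hq.support_nodup, ?_⟩
    rintro x hx y hy rfl
    exact hdisj x hx hy
  rw [← hT.length_eq_dist_of_isPath hpath, Walk.length_append, Walk.length_cons, hpl, hql]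
  omega

theorem Connected.exists_adj_dist_eq (hG : T.Connected) {u v : V} {k : ℕ}
    (h : T.dist u v = k + 1) : ∃ w, T.Adj u w ∧ T.dist w v = k := by
  obtain ⟨p, hp⟩ := hG.exists_walk_length_eq_dist u v
  cases p with
  | nil => simp at h
  | @cons _ w _ huw q =>
    refine ⟨w, huw, ?_⟩
    have h1 := T.dist_le q
    rw [Walk.length_cons] at hp
    have h2 := hG.dist_triangle (u := u) (v := w) (w := v)
    have h3 := dist_eq_one_iff_adj.mpr huw
    omega

/-- Three vertices of a tree have a median. -/
theorem IsTree.exists_median (hT : T.IsTree) (r s x : V) :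
    ∃ p, T.dist x p + T.dist p r = T.dist x r ∧ T.dist x p + T.dist p s = T.dist x s ∧
      T.dist r p + T.dist p s = T.dist r s := by
  suffices h : ∀ k x, T.dist x r = k → ∃ p, T.dist x p + T.dist p r = T.dist x r ∧
      T.dist x p + T.dist p s = T.dist x s ∧ T.dist r p + T.dist p s = T.dist r s from h _ x rfl
  intro k
  induction k with
  | zero =>
    intro x hx
    obtain rfl := hT.connected.dist_eq_zero_iff.mp hx
    exact ⟨x, by simp, by simp, by simp⟩
  | succ k ih =>
    intro x hx
    obtain ⟨w, hxw, hw⟩ := hT.connected.exists_adj_dist_eq hx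
    obtain ⟨p, h1, h2, h3⟩ := ih w hw
    have hxp := hT.connected.dist_triangle (u := x) (v := w) (w := p)
    have hxr := hT.connected.dist_triangle (u := x) (v := p) (w := r)
    have hxs := hT.connected.dist_triangle (u := x) (v := p) (w := s)
    have e1 := dist_eq_one_iff_adj.mpr hxw
    -- If the step towards `r` also approaches `s`, the median of `w` serves for `x`. Otherwise the
    -- edge separates `r` from `s`, and `x` itself is the median.
    rcases hT.dist_eq_dist_add_one_of_adj s hxw with h | h
    · refine ⟨p, ?_, ?_, h3⟩
      · omega
      · rw [T.dist_comm (u := s) (v := x), T.dist_comm (u := s) (v := w)] at h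
        omega
    · have := hT.dist_eq_of_separating_adj (r := r) (s := s) hxw.symm
        (by rw [T.dist_comm (u := r), T.dist_comm (u := r)]; omega)
        (by rw [T.dist_comm (v := s), T.dist_comm (v := s)]; omega)
      refine ⟨x, by simp, by simp, ?_⟩
      rw [T.dist_comm (u := r) (v := w)] at this
      rw [T.dist_comm (u := r) (v := x)]
      omega

/-- Vertices between two given vertices of a tree are determined by their distance to one of
these, and their mutual distances are differences of such distances. -/
theorem IsTree.dist_between (hT : T.IsTree) {x y z w : V}
    (hz : T.dist x z + T.dist z y = T.dist x y) (hw : T.dist x w + T.dist w y = T.dist x y)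
    (hzw : T.dist x z ≤ T.dist x w) : T.dist x z + T.dist z w = T.dist x w := by
  obtain ⟨p, hp, hpl⟩ := hT.connected.exists_path_of_dist x y
  have on_path : ∀ {z}, T.dist x z + T.dist z y = T.dist x y → p.getVert (T.dist x z) = z := by
    intro z hz
    obtain ⟨a, ha⟩ := hT.connected.exists_walk_length_eq_dist x z
    obtain ⟨b, hb⟩ := hT.connected.exists_walk_length_eq_dist z y
    have hab : (a.append b).length = T.dist x y := by rw [Walk.length_append, ha, hb, hz]
    have := (hT.existsUnique_path x y).unique hp ((a.append b).isPath_of_length_eq_dist hab)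
    rw [this, ← ha, Walk.getVert_append]
    simp
  have h1 : T.dist z w ≤ T.dist x w - T.dist x z := by
    have hz' := on_path hz
    have hw' := on_path hw
    have h : T.dist (p.getVert (T.dist x z))
        (p.getVert (T.dist x z + (T.dist x w - T.dist x z))) ≤ T.dist x w - T.dist x z := by
      rw [← Walk.drop_getVert]
      refine (T.dist_le ((p.drop (T.dist x z)).take (T.dist x w - T.dist x z))).trans ?_
      rw [Walk.take_length]
      exact min_le_left _ _
    rwa [Nat.add_sub_cancel' hzw, hz', hw'] at h
  have := hT.connected.dist_triangle (u := x) (v := z) (w := w)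
  omega

theorem IsTree.eq_of_between (hT : T.IsTree) {x y z w : V}
    (hz : T.dist x z + T.dist z y = T.dist x y) (hw : T.dist x w + T.dist w y = T.dist x y)
    (hzw : T.dist x z = T.dist x w) : z = w := by
  have := hT.dist_between hz hw hzw.le
  exact hT.connected.dist_eq_zero_iff.mp (by omega)

theorem Connected.exists_between (hG : T.Connected) {x y : V} {k : ℕ} (hk : k ≤ T.dist x y) :
    ∃ z, T.dist x z = k ∧ T.dist z y = T.dist x y - k := by
  induction k with
  | zero => exact ⟨x, by simp, by simp⟩
  | succ k ih =>
    obtain ⟨z, h1, h2⟩ := ih (by omega)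
    obtain ⟨w, hzw, hw⟩ := hG.exists_adj_dist_eq (u := z) (v := y) (k := T.dist x y - (k + 1))
      (by omega)
    have h3 := dist_eq_one_iff_adj.mpr hzw
    have h4 := hG.dist_triangle (u := x) (v := z) (w := w)
    have h5 := hG.dist_triangle (u := x) (v := w) (w := y)
    exact ⟨w, by omega, hw⟩

/-- A vertex of a tree farthest from a given one may be found among the ends of a diametral
path. -/
theorem IsTree.dist_le_max_of_diametral (hT : T.IsTree) {x y : V}
    (hd : ∀ u v, T.dist u v ≤ T.dist x y) (r s : V) :
    T.dist r s ≤ max (T.dist r x) (T.dist r y) := by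
  obtain ⟨p, hp1, hp2, hp3⟩ := hT.exists_median r s x
  obtain ⟨q, hq1, hq2, hq3⟩ := hT.exists_median r s y
  have h1 := hd x s
  have h2 := hd s y
  have h3 := hT.connected.dist_triangle (u := x) (v := p) (w := y)
  have h4 := hT.connected.dist_triangle (u := p) (v := q) (w := y)
  have c1 := T.dist_comm (u := p) (v := r)
  have c2 := T.dist_comm (u := q) (v := r)
  have c3 := T.dist_comm (u := q) (v := y)
  have c4 := T.dist_comm (u := x) (v := r)
  have c5 := T.dist_comm (u := y) (v := r)
  have c6 := T.dist_comm (u := s) (v := y)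
  have c7 := T.dist_comm (u := q) (v := p)
  rw [le_max_iff]
  -- `p` and `q` are the feet of `x` and `y` on the path from `r` to `s`. If `p` comes first,
  -- maximality of d(x, y) against d(x, s) gives d(q, s) ≤ d(q, y), so `y` is at least as far from
  -- `r` as `s`. The other order is symmetric.
  rcases le_total (T.dist r p) (T.dist r q) with h | h
  · have := hT.dist_between hp3 hq3 h
    omega
  · have := hT.dist_between hq3 hp3 h
    omega

end SimpleGraph

/-! ### Eccentricity matrices of trees and of their complements. -/

namespace SimpleGraph

variable {V : Type*}

theorem Connected.eccent_eq {G : SimpleGraph V} (hG : G.Connected) {u v : V} {k : ℕ}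
    (h : ∀ w, G.dist u w ≤ k) (hv : G.dist u v = k) : G.eccent u = k := by
  refine le_antisymm ((eccent_le_iff _ _).mpr fun w => ?_) ?_
  · rw [← (hG u w).coe_dist_eq_edist]
    exact_mod_cast h w
  · rw [← hv, (hG u v).coe_dist_eq_edist]
    exact edist_le_eccent

theorem eccMatrix_apply {G : SimpleGraph V} {u v : V} {a b : ℕ} (hu : G.eccent u = a)
    (hv : G.eccent v = b) :
    G.eccMatrix u v = if G.dist u v = min a b then (G.dist u v : ℝ) else 0 := by
  simp only [eccMatrix, Matrix.of_apply, hu, hv, ← Nat.mono_cast.map_min, Nat.cast_inj]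

theorem eccMatrix_nonneg (G : SimpleGraph V) (u v : V) : 0 ≤ G.eccMatrix u v := by
  simp only [eccMatrix, Matrix.of_apply]
  split_ifs <;> positivity

theorem eccMatrix_comm (G : SimpleGraph V) (u v : V) : G.eccMatrix u v = G.eccMatrix v u := by
  simpa using G.eccMatrix_isHermitian.apply v u

theorem eccMatrix_self (G : SimpleGraph V) (u : V) : G.eccMatrix u u = 0 := by
  simp [eccMatrix]

theorem trace_eccMatrix [Fintype V] (G : SimpleGraph V) : G.eccMatrix.trace = 0 := by
  simp [Matrix.trace, eccMatrix_self]

theorem eccEnergy_eq_traceNorm [Fintype V] [DecidableEq V] (G : SimpleGraph V) :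
    G.eccEnergy = G.eccMatrix_isHermitian.traceNorm := rfl

variable {T : SimpleGraph V}

theorem IsTree.eccent_eq_of_diametral (hT : T.IsTree) {x y : V}
    (hd : ∀ u v, T.dist u v ≤ T.dist x y) (r : V) :
    T.eccent r = (max (T.dist r x) (T.dist r y) : ℕ) := by
  rcases le_total (T.dist r x) (T.dist r y) with h | h
  · exact hT.connected.eccent_eq (hT.dist_le_max_of_diametral hd r) (v := y) (max_eq_right h).symm
  · exact hT.connected.eccent_eq (hT.dist_le_max_of_diametral hd r) (v := x) (max_eq_left h).symm

theorem IsTree.eccMatrix_eq_dist_of_diametral (hT : T.IsTree) {x y : V}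
    (hd : ∀ u v, T.dist u v ≤ T.dist x y) {u v : V}
    (h : T.dist u v = min (max (T.dist u x) (T.dist u y)) (max (T.dist v x) (T.dist v y))) :
    T.eccMatrix u v = T.dist u v := by
  rw [eccMatrix_apply (hT.eccent_eq_of_diametral hd u) (hT.eccent_eq_of_diametral hd v), if_pos h]

theorem IsTree.eccMatrix_eq_zero_of_diametral (hT : T.IsTree) {x y : V}
    (hd : ∀ u v, T.dist u v ≤ T.dist x y) {u v : V}
    (h : T.dist u v ≠ min (max (T.dist u x) (T.dist u y)) (max (T.dist v x) (T.dist v y))) :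
    T.eccMatrix u v = 0 := by
  rw [eccMatrix_apply (hT.eccent_eq_of_diametral hd u) (hT.eccent_eq_of_diametral hd v), if_neg h]

/-- The distance from `r` to its farther diametral end is the eccentricity of `r`, and that end has
eccentricity equal to the diameter, so the minimum is attained. These entries form the stars used
for large diameter. -/
theorem IsTree.eccMatrix_left_of_diametral (hT : T.IsTree) {x y : V}
    (hd : ∀ u v, T.dist u v ≤ T.dist x y) {r : V} (h : T.dist r y ≤ T.dist r x) :
    T.eccMatrix r x = T.dist r x := by
  apply hT.eccMatrix_eq_dist_of_diametral hd
  have := hd r x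
  rw [T.dist_self]
  omega

theorem IsTree.eccMatrix_right_of_diametral (hT : T.IsTree) {x y : V}
    (hd : ∀ u v, T.dist u v ≤ T.dist x y) {r : V} (h : T.dist r x ≤ T.dist r y) :
    T.eccMatrix r y = T.dist r y := by
  apply hT.eccMatrix_eq_dist_of_diametral hd
  have := hd r y
  have := T.dist_comm (u := y) (v := x)
  rw [T.dist_self]
  omega

/-- The distances of a vertex of a tree to two others have sum of the parity of the distance of
the latter. -/
theorem IsTree.exists_dist_add_dist_eq (hT : T.IsTree) (r x y : V) :
    ∃ k, T.dist r x + T.dist r y = T.dist x y + 2 * k := by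
  obtain ⟨p, h1, h2, h3⟩ := hT.exists_median x y r
  refine ⟨T.dist r p, ?_⟩
  have := T.dist_comm (u := x) (v := p)
  omega

theorem dist_compl_of_not_adj {u v : V} (h : ¬T.Adj u v) (hne : u ≠ v) : Tᶜ.dist u v = 1 :=
  dist_eq_one_iff_adj.mpr ((compl_adj _ _ _).mpr ⟨hne, h⟩)

theorem dist_compl_of_adj {u v w : V} (h : T.Adj u v) (hu : Tᶜ.Adj u w) (hv : Tᶜ.Adj w v) :
    Tᶜ.dist u v = 2 := by
  have h1 := Tᶜ.dist_le (Walk.cons hu (Walk.cons hv Walk.nil))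
  have h2 : Tᶜ.dist u v ≠ 1 := fun h' => ((compl_adj _ _ _).mp (dist_eq_one_iff_adj.mp h')).2 h
  have h3 : Tᶜ.dist u v ≠ 0 := by
    refine dist_ne_zero_iff_ne_and_reachable.mpr ⟨h.ne, ?_⟩
    exact (Walk.cons hu (Walk.cons hv Walk.nil)).reachable
  simp only [Walk.length_cons, Walk.length_nil] at h1
  omega

/-- Some vertex is distinct from and nonadjacent to both ends of the edge, since otherwise all
vertices would lie so close to the edge that no two are at distance four. Hence distances in the
complement are at most 2, and ends of tree edges attain 2. -/
theorem IsTree.eccMatrix_compl_of_adj (hT : T.IsTree) (hTc : Tᶜ.Connected) {x y : V}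
    (hxy : 4 ≤ T.dist x y) {u v : V} (huv : T.Adj u v) : Tᶜ.eccMatrix u v = 2 := by
  have hdist : ∀ {u v}, T.Adj u v → Tᶜ.dist u v = 2 := by
    intro u v huv
    by_contra hne
    have hcov : ∀ w, T.dist w u ≤ 1 ∧ T.dist w v ≤ 2 ∨ T.dist w v ≤ 1 ∧ T.dist w u ≤ 2 := by
      intro w
      have h1 := dist_eq_one_iff_adj.mpr huv
      have h2 := hT.connected.dist_triangle (u := w) (v := u) (w := v)
      have h3 := hT.connected.dist_triangle (u := w) (v := v) (w := u)
      have h4 := T.dist_comm (u := u) (v := v)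
      by_contra hw
      have hu1 : 1 < T.dist w u := by omega
      have hv1 : 1 < T.dist w v := by omega
      refine hne (dist_compl_of_adj (w := w) huv ((compl_adj _ _ _).mpr ⟨?_, ?_⟩)
        ((compl_adj _ _ _).mpr ⟨?_, ?_⟩))
      · rintro rfl
        simp at hu1
      · intro h
        have := dist_eq_one_iff_adj.mpr h.symm
        omega
      · rintro rfl
        simp at hv1
      · intro h
        have := dist_eq_one_iff_adj.mpr h
        omega
    have h1 := hT.connected.dist_triangle (u := x) (v := u) (w := y)
    have h2 := hT.connected.dist_triangle (u := x) (v := v) (w := y)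
    have h3 := T.dist_comm (u := u) (v := y)
    have h4 := T.dist_comm (u := v) (v := y)
    have := hcov x
    have := hcov y
    omega
  have hle : ∀ u w, Tᶜ.dist u w ≤ 2 := by
    intro u w
    rcases eq_or_ne u w with rfl | hne
    · simp
    by_cases h : T.Adj u w
    · exact (hdist h).le
    · rw [dist_compl_of_not_adj h hne]
      norm_num
  rw [eccMatrix_apply (hTc.eccent_eq (hle u) (hdist huv))
    (hTc.eccent_eq (hle v) (hdist huv.symm)), hdist huv]
  simp

/-- The n - 1 edges contribute 2 · 4 each to the squared Frobenius norm, and the trace is zero. -/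
theorem IsTree.four_mul_sqrt_le_eccEnergy_compl [Fintype V] [DecidableEq V] (hT : T.IsTree)
    (hTc : Tᶜ.Connected) {x y : V} (hxy : 4 ≤ T.dist x y) :
    4 * √((Fintype.card V : ℝ) - 1) ≤ Tᶜ.eccEnergy := by
  classical
  have hs : 8 * ((Fintype.card V : ℝ) - 1) ≤ ∑ u, ∑ v, Tᶜ.eccMatrix u v ^ 2 := by
    have h1 : ∑ u, ∑ v, (if T.Adj u v then (4 : ℝ) else 0) ≤ ∑ u, ∑ v, Tᶜ.eccMatrix u v ^ 2 := by
      refine Finset.sum_le_sum fun u _ => Finset.sum_le_sum fun v _ => ?_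
      split_ifs with h
      · rw [hT.eccMatrix_compl_of_adj hTc hxy h]
        norm_num
      · positivity
    refine le_trans (le_of_eq ?_) h1
    have h2 : ∀ u, ∑ v, (if T.Adj u v then (4 : ℝ) else 0) = 4 * (T.degree u : ℝ) := by
      intro u
      rw [← Finset.sum_filter, Finset.sum_const, nsmul_eq_mul, ← neighborFinset_eq_filter,
        card_neighborFinset_eq_degree, mul_comm]
    rw [Finset.sum_congr rfl fun u _ => h2 u, ← Finset.mul_sum]
    have h3 : (∑ u, (T.degree u : ℝ)) = 2 * (T.edgeFinset.card : ℝ) := by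
      exact_mod_cast T.sum_degrees_eq_twice_card_edges
    have h4 : (T.edgeFinset.card : ℝ) + 1 = Fintype.card V := by
      exact_mod_cast hT.card_edgeFinset
    rw [h3]
    linarith
  have := Tᶜ.eccMatrix_isHermitian.sqrt_le_traceNorm hs (t := 0) (by simp [trace_eccMatrix])
  refine le_trans (le_of_eq ?_) this
  rw [show 2 * (8 * ((Fintype.card V : ℝ) - 1)) - 0 ^ 2 = 4 ^ 2 * ((Fintype.card V : ℝ) - 1) by ring,
    Real.sqrt_mul (by norm_num), Real.sqrt_sq (by norm_num)]

end SimpleGraph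

/-! ### Frobenius bounds for blocks and stars. -/

namespace Matrix

variable {V : Type*} [Fintype V] [DecidableEq V]

/-- Of the entries indexed by `Q` ∪ `R`, only the block on `R` is dropped. Below, `Q` is the centre
of a star or the vertex set of a diametral path. -/
theorem IsHermitian.sum_sq_add_two_mul_sum_sq_le {N : Matrix V V ℝ} (hN : N.IsHermitian)
    {Q R : Finset V} (hQR : Disjoint Q R) :
    (∑ u ∈ Q, ∑ v ∈ Q, N u v ^ 2) + 2 * ∑ r ∈ R, ∑ u ∈ Q, N r u ^ 2 ≤ ∑ u, ∑ v, N u v ^ 2 := by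
  have hsymm : ∀ u v, N u v = N v u := fun u v => by simpa using hN.apply v u
  have h1 : ∑ u ∈ Q ∪ R, ∑ v ∈ Q ∪ R, N u v ^ 2 ≤ ∑ u, ∑ v, N u v ^ 2 := by
    calc _ ≤ ∑ u ∈ Q ∪ R, ∑ v, N u v ^ 2 := Finset.sum_le_sum fun u _ =>
          Finset.sum_le_univ_sum_of_nonneg fun v => sq_nonneg _
      _ ≤ _ := Finset.sum_le_univ_sum_of_nonneg fun u =>
          Finset.sum_nonneg fun v _ => sq_nonneg _
  have h2 : ∑ u ∈ Q, ∑ r ∈ R, N u r ^ 2 = ∑ r ∈ R, ∑ u ∈ Q, N r u ^ 2 := by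
    rw [Finset.sum_comm]
    exact Finset.sum_congr rfl fun r _ => Finset.sum_congr rfl fun u _ => by rw [hsymm]
  have h3 : 0 ≤ ∑ r ∈ R, ∑ s ∈ R, N r s ^ 2 :=
    Finset.sum_nonneg fun _ _ => Finset.sum_nonneg fun _ _ => sq_nonneg _
  simp only [Finset.sum_union hQR, Finset.sum_add_distrib] at h1
  linarith

/-- Pinching along a partition of the index set into two parts containing disjoint stars. -/
theorem IsHermitian.sqrt_star_add_sqrt_star_le {M : Matrix V V ℝ} (hM : M.IsHermitian)
    (h0 : ∀ u, M u u = 0) {x y : V} {R S : Finset V} (hxR : x ∉ R) (hyS : y ∉ S)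
    (hxS : x ∉ S) (hyR : y ∉ R) (hxy : x ≠ y) (hRS : Disjoint R S) :
    2 * (√(∑ r ∈ R, M r x ^ 2) + √(∑ s ∈ S, M s y ^ 2)) ≤ hM.traceNorm := by
  let P : Matrix V V ℝ := diagonal fun v => if v ∈ insert x R then 1 else 0
  let Q : Matrix V V ℝ := diagonal fun v => if v ∈ insert x R then 0 else 1
  have hP : P.IsHermitian := isHermitian_diagonal _
  have hQ : Q.IsHermitian := isHermitian_diagonal _
  have hPP : P * P = P := by simp [P, diagonal_mul_diagonal]
  have hQQ : Q * Q = Q := by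
    simp only [Q, diagonal_mul_diagonal, mul_ite, mul_zero, mul_one]
    congr 1
    ext v
    split_ifs <;> rfl
  have hPQ : P + Q = 1 := by
    rw [diagonal_add, ← diagonal_one]
    congr 1
    ext v
    split_ifs <;> norm_num
  have key := hM.traceNorm_compression_add_le hP hQ hPP hQQ hPQ
  have bound : ∀ {D : Matrix V V ℝ} (hD : D.IsHermitian) (d : V → ℝ) (_ : D = diagonal d) (z : V)
      (A : Finset V) (_ : z ∉ A) (_ : d z = 1) (_ : ∀ a ∈ A, d a = 1),
      2 * √(∑ a ∈ A, M a z ^ 2) ≤ (hM.compression hD).traceNorm := by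
    intro D hD d hDd z A hzA hdz hdA
    have happ : ∀ u v, (D * M * D) u v = d u * M u v * d v := by
      intro u v
      rw [hDd, mul_diagonal, diagonal_mul]
    have h1 := (hM.compression hD).sum_sq_add_two_mul_sum_sq_le
      (Finset.disjoint_singleton_left.mpr hzA)
    simp only [Finset.sum_singleton, happ, h0, mul_zero, zero_mul] at h1
    have h2 : ∑ a ∈ A, (d a * M a z * d z) ^ 2 = ∑ a ∈ A, M a z ^ 2 :=
      Finset.sum_congr rfl fun a ha => by rw [hdA a ha, hdz]; ring
    rw [h2] at h1
    have h3 := (hM.compression hD).sqrt_le_traceNorm (f := 2 * ∑ a ∈ A, M a z ^ 2) (t := 0)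
      (by simp only [happ]; linarith) (by simp [trace, happ, h0])
    refine le_trans (le_of_eq ?_) h3
    rw [show 2 * (2 * ∑ a ∈ A, M a z ^ 2) - 0 ^ 2 = 2 ^ 2 * ∑ a ∈ A, M a z ^ 2 by ring,
      Real.sqrt_mul (by norm_num), Real.sqrt_sq (by norm_num)]
  have b1 := bound hP _ rfl x R hxR (by simp) (fun a ha => by simp [ha])
  have b2 := bound hQ _ rfl y S hyS (by simp [hxy.symm, hyR]) (fun a ha => by
    have h1 : a ≠ x := fun h => hxS (h ▸ ha)
    have h2 : a ∉ R := fun h => Finset.disjoint_left.mp hRS h ha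
    simp [h1, h2])
  linarith

end Matrix

/-- By concavity the sum of roots is least at an extreme splitting of p + q; concretely the claim is
(√p - 5)(√q - 5) ≥ 0. -/
theorem Real.five_add_sqrt_le_sqrt_add_sqrt {p q k : ℝ} (hp : 25 ≤ p) (hq : 25 ≤ q)
    (hk : k ≤ p + q) : 5 + √(k - 25) ≤ √p + √q := by
  have h1 : √(k - 25) ≤ √(p + q - 25) := Real.sqrt_le_sqrt (by linarith)
  have hp2 := Real.sq_sqrt (show 0 ≤ p by linarith)
  have hq2 := Real.sq_sqrt (show 0 ≤ q by linarith)
  have hp5 : 5 ≤ √p := Real.le_sqrt_of_sq_le (by linarith)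
  have hq5 : 5 ≤ √q := Real.le_sqrt_of_sq_le (by linarith)
  have h2 : √(p + q - 25) ≤ √p + √q - 5 := by
    rw [Real.sqrt_le_iff]
    exact ⟨by linarith, by nlinarith⟩
  linarith

/-! ### Trees of diameter at least five. -/

namespace SimpleGraph

variable {V : Type*} [Fintype V] [DecidableEq V] {T : SimpleGraph V}

/-- Each vertex other than `x`, `y` joins the star of its farther diametral end, with its
eccentricity as weight. Two path vertices next to each end give each star squared weight at least 4²
+ 3² = 25, and the total is at least 16(n - 2) - 14. -/
theorem IsTree.le_eccEnergy_of_five_le_diam (hT : T.IsTree) {x y : V}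
    (hd : ∀ u v, T.dist u v ≤ T.dist x y) (h5 : 5 ≤ T.dist x y) :
    2 * (5 + √(16 * (Fintype.card V : ℝ) - 71)) ≤ T.eccEnergy := by
  classical
  have hd' : ∀ u v, T.dist u v ≤ T.dist y x := fun u v => T.dist_comm (u := x) ▸ hd u v
  have hxy : x ≠ y := by
    rintro rfl
    simp at h5
  let R : Finset V := Finset.univ.filter fun r => r ≠ y ∧ T.dist r y < T.dist r x
  let S : Finset V := Finset.univ.filter fun r => r ≠ x ∧ T.dist r x ≤ T.dist r y
  have hR : ∀ r, r ∈ R ↔ r ≠ y ∧ T.dist r y < T.dist r x := fun r => by simp [R]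
  have hS : ∀ r, r ∈ S ↔ r ≠ x ∧ T.dist r x ≤ T.dist r y := fun r => by simp [S]
  have hRS : Disjoint R S := Finset.disjoint_left.mpr fun r h1 h2 => by
    have := (hR r).mp h1
    have := (hS r).mp h2
    omega
  have hxR : x ∉ R := fun h => by simpa using (hR x).mp h
  have hyS : y ∉ S := fun h => by
    have := ((hS y).mp h).2
    rw [T.dist_self, T.dist_comm] at this
    omega
  have key := T.eccMatrix_isHermitian.sqrt_star_add_sqrt_star_le T.eccMatrix_self hxR hyS
    (fun h => ((hS x).mp h).1 rfl) (fun h => ((hR y).mp h).1 rfl) hxy hRS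
  have eR : ∑ r ∈ R, T.eccMatrix r x ^ 2 = ∑ r ∈ R, (T.dist r x : ℝ) ^ 2 :=
    Finset.sum_congr rfl fun r hr => by
      rw [hT.eccMatrix_left_of_diametral hd ((hR r).mp hr).2.le]
  have eS : ∑ r ∈ S, T.eccMatrix r y ^ 2 = ∑ r ∈ S, (T.dist r y : ℝ) ^ 2 :=
    Finset.sum_congr rfl fun r hr => by
      rw [hT.eccMatrix_right_of_diametral hd ((hS r).mp hr).2]
  rw [eR, eS, ← eccEnergy_eq_traceNorm] at key
  refine le_trans ?_ key
  have pair : ∀ (A : Finset V) (f : V → ℕ) (a b : V), a ∈ A → b ∈ A → a ≠ b → 4 ≤ f a → 3 ≤ f b →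
      (25 : ℝ) ≤ ∑ r ∈ A, (f r : ℝ) ^ 2 := by
    intro A f a b ha hb hab h4 h3
    have h4' : (4 : ℝ) ≤ f a := by exact_mod_cast h4
    have h3' : (3 : ℝ) ≤ f b := by exact_mod_cast h3
    calc (25 : ℝ) ≤ ∑ r ∈ {a, b}, (f r : ℝ) ^ 2 := by
          rw [Finset.sum_pair hab]
          nlinarith
      _ ≤ _ := Finset.sum_le_sum_of_subset_of_nonneg
          (Finset.insert_subset ha (Finset.singleton_subset_iff.mpr hb))
          fun _ _ _ => by positivity
  obtain ⟨a₁, ha₁, hb₁⟩ := hT.connected.exists_between (x := x) (y := y) (k := 1) (by omega)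
  obtain ⟨a₂, ha₂, hb₂⟩ := hT.connected.exists_between (x := x) (y := y) (k := 2) (by omega)
  obtain ⟨a₃, ha₃, hb₃⟩ := hT.connected.exists_between (x := x) (y := y) (k := 3) (by omega)
  obtain ⟨c₁, hc₁, he₁⟩ := hT.connected.exists_between (x := y) (y := x) (k := 1)
    (by rw [T.dist_comm]; omega)
  obtain ⟨c₂, hc₂, he₂⟩ := hT.connected.exists_between (x := y) (y := x) (k := 2)
    (by rw [T.dist_comm]; omega)
  have hyx := T.dist_comm (u := y) (v := x)
  rw [T.dist_comm] at ha₁ ha₂ ha₃ hc₁ hc₂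
  have hp : (25 : ℝ) ≤ ∑ r ∈ R, (T.dist r x : ℝ) ^ 2 := by
    refine pair R (T.dist · x) c₁ c₂ ((hR _).mpr ⟨?_, by omega⟩) ((hR _).mpr ⟨?_, by omega⟩) ?_
      (by omega) (by omega)
    · rintro rfl
      simp at hc₁
    · rintro rfl
      simp at hc₂
    · rintro rfl
      omega
  have hq : (25 : ℝ) ≤ ∑ r ∈ S, (T.dist r y : ℝ) ^ 2 := by
    refine pair S (T.dist · y) a₁ a₂ ((hS _).mpr ⟨?_, by omega⟩) ((hS _).mpr ⟨?_, by omega⟩) ?_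
      (by omega) (by omega)
    · rintro rfl
      simp at ha₁
    · rintro rfl
      simp at ha₂
    · rintro rfl
      omega
  have hpq : 16 * (Fintype.card V : ℝ) - 46 ≤
      ∑ r ∈ R, (T.dist r x : ℝ) ^ 2 + ∑ r ∈ S, (T.dist r y : ℝ) ^ 2 := by
    -- Eccentricities are at least 4 except possibly at these two path vertices, where the square
    -- may be 9 = 16 - 7.
    let g : V → ℝ := fun r => 16 - (if r = a₂ then 7 else 0) - (if r = a₃ then 7 else 0)
    have hg : ∀ r, r ≠ x → r ≠ y → g r ≤ (max (T.dist r x) (T.dist r y) : ℕ) ^ 2 := by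
      intro r hrx hry
      have h1 := hT.connected.dist_triangle (u := x) (v := r) (w := y)
      have hc := T.dist_comm (u := x) (v := r)
      rcases Nat.lt_or_ge (max (T.dist r x) (T.dist r y)) 4 with h | h
      -- Parity excludes distances 3 and 3 to ends that are at distance 5, so a vertex of
      -- eccentricity 3 lies on the diametral path.
      · obtain ⟨k, hk⟩ := hT.exists_dist_add_dist_eq r x y
        have h3 : 3 ≤ max (T.dist r x) (T.dist r y) := by omega
        have hor : r = a₂ ∨ r = a₃ := by
          have h2 : T.dist r x = 2 ∨ T.dist r x = 3 := by omega
          rcases h2 with h2 | h2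
          · refine Or.inl (hT.eq_of_between (x := x) (y := y) (by omega) ?_ ?_)
            · rw [T.dist_comm (u := x)]; omega
            · rw [hc, T.dist_comm (u := x)]; omega
          · refine Or.inr (hT.eq_of_between (x := x) (y := y) (by omega) ?_ ?_)
            · rw [T.dist_comm (u := x)]; omega
            · rw [hc, T.dist_comm (u := x)]; omega
        have h3' : (3 : ℝ) ≤ (max (T.dist r x) (T.dist r y) : ℕ) := by exact_mod_cast h3
        have : g r ≤ 9 := by
          simp only [g]
          rcases hor with h | h
          · rw [if_pos h]; split_ifs <;> norm_num
          · rw [if_pos h]; split_ifs <;> norm_num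
        nlinarith
      · have h4 : (4 : ℝ) ≤ (max (T.dist r x) (T.dist r y) : ℕ) := by exact_mod_cast h
        have : g r ≤ 16 := by
          simp only [g]
          split_ifs <;> norm_num
        nlinarith
    have e1 : ∑ r ∈ R, (T.dist r x : ℝ) ^ 2
        = ∑ r ∈ R, ((max (T.dist r x) (T.dist r y) : ℕ) : ℝ) ^ 2 :=
      Finset.sum_congr rfl fun r hr => by rw [max_eq_left ((hR r).mp hr).2.le]
    have e2 : ∑ r ∈ S, (T.dist r y : ℝ) ^ 2
        = ∑ r ∈ S, ((max (T.dist r x) (T.dist r y) : ℕ) : ℝ) ^ 2 :=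
      Finset.sum_congr rfl fun r hr => by rw [max_eq_right ((hS r).mp hr).2]
    have hU : R ∪ S = (Finset.univ.erase x).erase y := by
      ext r
      simp only [Finset.mem_union, hR, hS, Finset.mem_erase, Finset.mem_univ, and_true]
      constructor
      · rintro (⟨h1, h2⟩ | ⟨h1, h2⟩)
        · refine ⟨h1, ?_⟩
          rintro rfl
          simp at h2
        · refine ⟨?_, h1⟩
          rintro rfl
          rw [T.dist_self] at h2
          omega
      · rintro ⟨h1, h2⟩
        rcases Nat.lt_or_ge (T.dist r y) (T.dist r x) with h | h
        · exact Or.inl ⟨h1, h⟩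
        · exact Or.inr ⟨h2, h⟩
    rw [e1, e2, ← Finset.sum_union hRS, hU]
    have e3 : ∑ r ∈ (Finset.univ.erase x).erase y, g r
        ≤ ∑ r ∈ (Finset.univ.erase x).erase y, ((max (T.dist r x) (T.dist r y) : ℕ) : ℝ) ^ 2 :=
      Finset.sum_le_sum fun r hr => by
        simp only [Finset.mem_erase] at hr
        exact hg r hr.2.1 hr.1
    have hcard : (((Finset.univ.erase x).erase y).card : ℝ) = (Fintype.card V : ℝ) - 2 := by
      have h1 := Finset.card_erase_add_one (Finset.mem_univ x)
      have h2 := Finset.card_erase_add_one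
        (show y ∈ (Finset.univ : Finset V).erase x by simp [hxy.symm])
      rw [Finset.card_univ] at h1
      have : ((Finset.univ.erase x).erase y).card + 2 = Fintype.card V := by omega
      rw [← this]
      push_cast
      ring
    refine le_trans ?_ e3
    simp only [g, Finset.sum_sub_distrib, Finset.sum_const, nsmul_eq_mul, hcard,
      Finset.sum_ite_eq']
    split_ifs <;> linarith
  have := Real.five_add_sqrt_le_sqrt_add_sqrt hp hq hpq
  rw [show 16 * (Fintype.card V : ℝ) - 46 - 25 = 16 * (Fintype.card V : ℝ) - 71 by ring] at this
  linarith

end SimpleGraph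

/-! ### Trees of diameter four: pinching along a reflection. -/

namespace Matrix

variable {V : Type*} [Fintype V] [DecidableEq V]

/-- Pinching to the vectors that are antisymmetric, respectively symmetric, under an involution of
the index set. -/
theorem IsHermitian.exists_antisymm_symm_pinching {M : Matrix V V ℝ} (hM : M.IsHermitian)
    {τ : V → V} (hτ : Function.Involutive τ) :
    ∃ (A B : Matrix V V ℝ) (hA : A.IsHermitian) (hB : B.IsHermitian),
      (∀ u v, A u v = (M u v - M (τ u) v - M u (τ v) + M (τ u) (τ v)) / 4) ∧
      (∀ u v, B u v = (M u v + M (τ u) v + M u (τ v) + M (τ u) (τ v)) / 4) ∧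
      hA.traceNorm + hB.traceNorm ≤ hM.traceNorm := by
  let S : Matrix V V ℝ := of fun u v => if τ u = v then 1 else 0
  have hS : S.IsHermitian := by
    ext u v
    simp only [S, conjTranspose_apply, of_apply, star_trivial]
    exact if_congr ⟨fun h => by rw [← h, hτ], fun h => by rw [← h, hτ]⟩ rfl rfl
  have hSA : ∀ (N : Matrix V V ℝ) u v, (S * N) u v = N (τ u) v := by
    intro N u v
    simp [S, mul_apply]
  have hAS : ∀ (N : Matrix V V ℝ) u v, (N * S) u v = N u (τ v) := by
    intro N u v
    have : ∀ w, τ w = v ↔ w = τ v := fun w =>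
      ⟨fun h => by rw [← h, hτ], fun h => by rw [h, hτ]⟩
    simp [S, mul_apply, this]
  have hSS : S * S = 1 := by
    ext u v
    rw [hSA, one_apply]
    simp [S, hτ u]
  let P : Matrix V V ℝ := (1 / 2 : ℝ) • (1 - S)
  let Q : Matrix V V ℝ := (1 / 2 : ℝ) • (1 + S)
  have hP : P.IsHermitian := by
    simp only [P, IsHermitian, conjTranspose_smul, conjTranspose_sub, conjTranspose_one, hS.eq,
      star_trivial]
  have hQ : Q.IsHermitian := by
    simp only [Q, IsHermitian, conjTranspose_smul, conjTranspose_add, conjTranspose_one, hS.eq,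
      star_trivial]
  have hPP : P * P = P := by
    simp only [P, smul_mul_smul_comm, Matrix.sub_mul, Matrix.mul_sub, hSS, Matrix.one_mul,
      Matrix.mul_one]
    module
  have hQQ : Q * Q = Q := by
    simp only [Q, smul_mul_smul_comm, Matrix.add_mul, Matrix.mul_add, hSS, Matrix.one_mul,
      Matrix.mul_one]
    module
  have hPQ : P + Q = 1 := by
    simp only [P, Q]
    module
  refine ⟨P * M * P, Q * M * Q, hM.compression hP, hM.compression hQ, fun u v => ?_, fun u v => ?_,
    hM.traceNorm_compression_add_le hP hQ hPP hQQ hPQ⟩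
  · have : P * M * P = (1 / 4 : ℝ) • (M - S * M - M * S + S * M * S) := by
      simp only [P, Matrix.smul_mul, Matrix.mul_smul, Matrix.sub_mul, Matrix.mul_sub, Matrix.one_mul,
        Matrix.mul_one]
      module
    rw [this]
    simp only [smul_apply, add_apply, sub_apply, hSA, hAS, smul_eq_mul]
    ring
  · have : Q * M * Q = (1 / 4 : ℝ) • (M + S * M + M * S + S * M * S) := by
      simp only [Q, Matrix.smul_mul, Matrix.mul_smul, Matrix.add_mul, Matrix.mul_add, Matrix.one_mul,
        Matrix.mul_one]
      module
    rw [this]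
    simp only [smul_apply, add_apply, hSA, hAS, smul_eq_mul]
    ring

/-- A lower bound for the trace norm of a matrix that contains the eccentricity matrix of a path
on five vertices, with ends `x`, `y`, their neighbours `a`, `b`, and centre `c`. -/
theorem IsHermitian.le_traceNorm_of_path_five {M : Matrix V V ℝ} (hM : M.IsHermitian)
    (h0 : ∀ u, M u u = 0) {x y a b c : V} (hnd : [x, y, a, b, c].Nodup)
    (hxy : M x y = 4) (hxa : M x a = 0) (hxb : M x b = 3) (hya : M y a = 3) (hyb : M y b = 0)
    (hab : M a b = 0) (hxc : M x c = 2) (hyc : M y c = 2)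
    (hr : ∀ r, r ∉ ({x, y, a, b, c} : Finset V) →
      33 / 2 ≤ 2 * ((M r x + M r y) / 2) ^ 2 + 2 * ((M r a + M r b) / 2) ^ 2 + M r c ^ 2) :
    2 * (√13 + √(33 / 2 * (Fintype.card V : ℝ) - 123 / 2)) ≤ hM.traceNorm := by
  have hs : ∀ u v, M u v = M v u := fun u v => by simpa using hM.apply v u
  have hnd' := hnd
  simp only [List.nodup_cons, List.mem_cons, List.not_mem_nil, or_false, not_or, not_false_eq_true,
    List.nodup_nil, and_true] at hnd
  obtain ⟨⟨n1, n2, n3, n4⟩, ⟨n5, n6, n7⟩, ⟨n8, n9⟩, n10⟩ := hnd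
  -- The reflection of the path, fixing all other vertices. It need not preserve `M`, since pinching
  -- holds for any involution.
  let τ : V → V := fun u => if u = x then y else if u = y then x else if u = a then b else
    if u = b then a else u
  have tx : τ x = y := by simp [τ]
  have ty : τ y = x := by simp [τ, Ne.symm n1]
  have ta : τ a = b := by simp [τ, Ne.symm n2, Ne.symm n5]
  have tb : τ b = a := by simp [τ, Ne.symm n3, Ne.symm n6, Ne.symm n8]
  have tr : ∀ r, r ≠ x → r ≠ y → r ≠ a → r ≠ b → τ r = r := by
    intro r h1 h2 h3 h4
    simp [τ, h1, h2, h3, h4]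
  have tc : τ c = c := tr c (Ne.symm n4) (Ne.symm n7) (Ne.symm n9) (Ne.symm n10)
  have hτ : Function.Involutive τ := by
    intro u
    by_cases h1 : u = x
    · rw [h1, tx, ty]
    by_cases h2 : u = y
    · rw [h2, ty, tx]
    by_cases h3 : u = a
    · rw [h3, ta, tb]
    by_cases h4 : u = b
    · rw [h4, tb, ta]
    rw [tr u h1 h2 h3 h4, tr u h1 h2 h3 h4]
  have htrace : ∑ u, M u (τ u) = 8 := by
    have h1 : ∑ u ∈ ({x, y, a, b} : Finset V), M u (τ u) = ∑ u, M u (τ u) := by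
      refine Finset.sum_subset (Finset.subset_univ _) fun u _ hu => ?_
      simp only [Finset.mem_insert, Finset.mem_singleton, not_or] at hu
      rw [tr u hu.1 hu.2.1 hu.2.2.1 hu.2.2.2, h0]
    rw [← h1, Finset.sum_insert (by simp [n1, n2, n3]), Finset.sum_insert (by simp [n5, n6]),
      Finset.sum_pair n8, tx, ty, ta, tb, hs y x, hs b a, hxy, hab]
    norm_num
  have htrace' : ∑ u, M (τ u) u = 8 := by
    rw [← htrace]
    exact Finset.sum_congr rfl fun u _ => hs _ _
  obtain ⟨A, B, hA, hB, eA, eB, key⟩ := hM.exists_antisymm_symm_pinching hτ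
  have trA : A.trace = -4 := by
    simp only [trace, diag, eA, h0]
    rw [← Finset.sum_div, Finset.sum_add_distrib, Finset.sum_sub_distrib, Finset.sum_sub_distrib,
      htrace, htrace']
    norm_num
  have trB : B.trace = 4 := by
    simp only [trace, diag, eB, h0]
    rw [← Finset.sum_div, Finset.sum_add_distrib, Finset.sum_add_distrib, Finset.sum_add_distrib,
      htrace, htrace']
    norm_num
  have bA : 2 * √13 ≤ hA.traceNorm := by
    -- On the normalized vectors x - y and a - b the compression has rows (-4, -3) and (-3, 0):
    -- squared norm 34, trace -4, giving 2 · 34 - 16 = 4 · 13.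
    have h1 := hA.sum_sq_add_two_mul_sum_sq_le
      (Finset.disjoint_empty_right ({x, y, a, b} : Finset V))
    have h2 : ∑ u ∈ ({x, y, a, b} : Finset V), ∑ v ∈ ({x, y, a, b} : Finset V), A u v ^ 2 = 34 := by
      simp only [Finset.sum_insert (show x ∉ ({y, a, b} : Finset V) by simp [n1, n2, n3]),
        Finset.sum_insert (show y ∉ ({a, b} : Finset V) by simp [n5, n6]), Finset.sum_pair n8,
        eA, tx, ty, ta, tb, h0, hs y x, hs a x, hs a y, hs b x, hs b y, hs b a, hxy, hxa, hxb, hya,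
        hyb, hab]
      norm_num
    rw [h2, Finset.sum_empty] at h1
    have h3 := hA.sqrt_le_traceNorm (f := 34) (t := 4) (by linarith) (by rw [trA]; norm_num)
    refine le_trans (le_of_eq ?_) h3
    rw [show (2 * 34 - 4 ^ 2 : ℝ) = 2 ^ 2 * 13 by norm_num, Real.sqrt_mul (by norm_num),
      Real.sqrt_sq (by norm_num)]
  have bB : 2 * √(33 / 2 * (Fintype.card V : ℝ) - 123 / 2) ≤ hB.traceNorm := by
    have h1 := hB.sum_sq_add_two_mul_sum_sq_le
      (disjoint_compl_right (a := ({x, y, a, b, c} : Finset V)))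
    -- The symmetric part has 16 from x + y alone, 2 · 9 between x + y and a + b, and 2 · 8 between
    -- x + y and `c`; the unspecified entries at `c` are discarded.
    have h2 : ∑ u ∈ ({x, y, a, b, c} : Finset V), ∑ v ∈ ({x, y, a, b, c} : Finset V),
        B u v ^ 2 ≥ 50 := by
      simp only [Finset.sum_insert (show x ∉ ({y, a, b, c} : Finset V) by simp [n1, n2, n3, n4]),
        Finset.sum_insert (show y ∉ ({a, b, c} : Finset V) by simp [n5, n6, n7]),
        Finset.sum_insert (show a ∉ ({b, c} : Finset V) by simp [n8, n9]), Finset.sum_pair n10,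
        eB, tx, ty, ta, tb, tc, h0, hs y x, hs a x, hs a y, hs b x, hs b y, hs b a, hs c x, hs c y,
        hs c a, hs c b, hxy, hxa, hxb, hya, hyb, hab, hxc, hyc]
      nlinarith [sq_nonneg ((M a c + M b c + M a c + M b c) / 4)]
    have h3 : ∀ r ∈ ({x, y, a, b, c} : Finset V)ᶜ,
        33 / 2 ≤ ∑ u ∈ ({x, y, a, b, c} : Finset V), B r u ^ 2 := by
      intro r hrc
      rw [Finset.mem_compl] at hrc
      have hb := hr r hrc
      simp only [Finset.mem_insert, Finset.mem_singleton, not_or] at hrc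
      have ht := tr r hrc.1 hrc.2.1 hrc.2.2.1 hrc.2.2.2.1
      simp only [Finset.sum_insert (show x ∉ ({y, a, b, c} : Finset V) by simp [n1, n2, n3, n4]),
        Finset.sum_insert (show y ∉ ({a, b, c} : Finset V) by simp [n5, n6, n7]),
        Finset.sum_insert (show a ∉ ({b, c} : Finset V) by simp [n8, n9]), Finset.sum_pair n10,
        eB, tx, ty, ta, tb, tc, ht]
      refine hb.trans (le_of_eq ?_)
      ring
    have h4 := Finset.card_nsmul_le_sum _ _ _ h3
    have hcard : ((({x, y, a, b, c} : Finset V)ᶜ.card : ℕ) : ℝ) = (Fintype.card V : ℝ) - 5 := by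
      have h5 : ({x, y, a, b, c} : Finset V).card = 5 := by
        have := List.toFinset_card_of_nodup hnd'
        simpa using this
      have h6 := Finset.card_add_card_compl ({x, y, a, b, c} : Finset V)
      rw [h5] at h6
      rw [← h6]
      push_cast
      ring
    rw [nsmul_eq_mul, hcard] at h4
    have h5 := hB.sqrt_le_traceNorm (f := 50 + 33 * ((Fintype.card V : ℝ) - 5)) (t := 4)
      (by linarith) (by rw [trB])
    refine le_trans (le_of_eq ?_) h5
    rw [show (2 * (50 + 33 * ((Fintype.card V : ℝ) - 5)) - 4 ^ 2 : ℝ)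
        = 2 ^ 2 * (33 / 2 * (Fintype.card V : ℝ) - 123 / 2) by ring, Real.sqrt_mul (by norm_num),
      Real.sqrt_sq (by norm_num)]
  linarith

end Matrix

namespace SimpleGraph

variable {V : Type*} [Fintype V] [DecidableEq V] {T : SimpleGraph V}

theorem IsTree.le_eccEnergy_of_diam_eq_four (hT : T.IsTree) {x y : V}
    (hd : ∀ u v, T.dist u v ≤ T.dist x y) (h4 : T.dist x y = 4) :
    2 * (√13 + √(33 / 2 * (Fintype.card V : ℝ) - 123 / 2)) ≤ T.eccEnergy := by
  obtain ⟨a, ha, ha'⟩ := hT.connected.exists_between (x := x) (y := y) (k := 1) (by omega)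
  obtain ⟨c, hc, hc'⟩ := hT.connected.exists_between (x := x) (y := y) (k := 2) (by omega)
  obtain ⟨b, hb, hb'⟩ := hT.connected.exists_between (x := x) (y := y) (k := 3) (by omega)
  rw [h4] at ha' hc' hb'
  replace ha' : T.dist a y = 3 := ha'
  replace hc' : T.dist c y = 2 := hc'
  replace hb' : T.dist b y = 1 := hb'
  have hab := hT.dist_between (x := x) (y := y) (z := a) (w := b) (by omega) (by omega) (by omega)
  have hac := hT.dist_between (x := x) (y := y) (z := a) (w := c) (by omega) (by omega) (by omega)
  have hcb := hT.dist_between (x := x) (y := y) (z := c) (w := b) (by omega) (by omega) (by omega)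
  have hsymm := fun u v => T.dist_comm (u := u) (v := v)
  have hpt : ∀ {u v : V} {k : ℕ}, T.dist u v = k → k ≠ 0 → u ≠ v := by
    rintro u v k h hk rfl
    simp at h
    exact hk h.symm
  have hyx := hsymm y x
  have hxa := hsymm a x
  have hxb := hsymm b x
  have hxc := hsymm c x
  have hya := hsymm y a
  have hyb := hsymm y b
  have hyc := hsymm y c
  have hbc := hsymm b c
  have entry : ∀ {u v : V} {k : ℕ}, T.dist u v = k →
      k = min (max (T.dist u x) (T.dist u y)) (max (T.dist v x) (T.dist v y)) →
      T.eccMatrix u v = k := by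
    intro u v k h1 h2
    rw [hT.eccMatrix_eq_dist_of_diametral hd (by omega), h1]
  have entry0 : ∀ {u v : V},
      T.dist u v ≠ min (max (T.dist u x) (T.dist u y)) (max (T.dist v x) (T.dist v y)) →
      T.eccMatrix u v = 0 := fun h => hT.eccMatrix_eq_zero_of_diametral hd h
  have hxx := T.dist_self (v := x)
  have hyy := T.dist_self (v := y)
  refine T.eccMatrix_isHermitian.le_traceNorm_of_path_five T.eccMatrix_self
    (x := x) (y := y) (a := a) (b := b) (c := c) ?_ ?_ ?_ ?_ ?_ ?_ ?_ ?_ ?_ ?_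
  · simp only [List.nodup_cons, List.mem_cons, List.not_mem_nil, or_false, not_or,
      not_false_eq_true, List.nodup_nil, and_true]
    refine ⟨⟨hpt h4 (by norm_num), hpt ha (by norm_num), hpt hb (by norm_num),
      hpt hc (by norm_num)⟩, ⟨Ne.symm (hpt ha' (by norm_num)), Ne.symm (hpt hb' (by norm_num)),
      Ne.symm (hpt hc' (by norm_num))⟩, ⟨hpt (k := 2) (by omega) (by norm_num),
      hpt (k := 1) (by omega) (by norm_num)⟩, Ne.symm (hpt (k := 1) (by omega) (by norm_num))⟩
  · exact_mod_cast entry (k := 4) (by omega) (by omega)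
  · exact entry0 (by omega)
  · exact_mod_cast entry (k := 3) (by omega) (by omega)
  · exact_mod_cast entry (k := 3) (by omega) (by omega)
  · exact entry0 (by omega)
  · exact entry0 (by omega)
  · exact_mod_cast entry (k := 2) (by omega) (by omega)
  · exact_mod_cast entry (k := 2) (by omega) (by omega)
  · intro r hr
    simp only [Finset.mem_insert, Finset.mem_singleton, not_or] at hr
    obtain ⟨hr1, hr2, hr3, hr4, hr5⟩ := hr
    obtain ⟨k, hk⟩ := hT.exists_dist_add_dist_eq r x y
    have hx4 := hd r x
    have hy4 := hd r y
    have hk0 : k ≠ 0 := by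
      rintro rfl
      have hb := fun {w : V} h1 h2 => hT.eq_of_between (x := x) (y := y) (z := r) (w := w)
        (by rw [hsymm x r]; omega) h1 h2
      rw [hsymm x r] at hb
      have h5 : T.dist r x = 0 ∨ T.dist r x = 1 ∨ T.dist r x = 2 ∨ T.dist r x = 3 ∨
          T.dist r x = 4 := by omega
      rcases h5 with h | h | h | h | h
      · exact hr1 (hT.connected.dist_eq_zero_iff.mp h)
      · exact hr3 (hb (by omega) (by omega))
      · exact hr5 (hb (by omega) (by omega))
      · exact hr4 (hb (by omega) (by omega))
      · exact hr2 (hT.connected.dist_eq_zero_iff.mp (by omega))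
    have nn := T.eccMatrix_nonneg r
    have n1 := nn x
    have n2 := nn y
    have n3 := nn a
    have n4 := nn b
    have tri1 := hT.connected.dist_triangle (u := r) (v := a) (w := x)
    have tri2 := hT.connected.dist_triangle (u := r) (v := b) (w := y)
    have tri3 := hT.connected.dist_triangle (u := r) (v := c) (w := x)
    have tri4 := hT.connected.dist_triangle (u := r) (v := c) (w := y)
    have max1 := hT.dist_le_max_of_diametral hd a r
    have max2 := hT.dist_le_max_of_diametral hd b r
    have max3 := hT.dist_le_max_of_diametral hd c r
    have hra := hsymm a r
    have hrb := hsymm b r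
    have hrc := hsymm c r
    -- Off the path the two distances have even sum at least 6. An end at distance 4 yields entries
    -- 4, 3, 2, hence 8 + 9/2 + 4 = 33/2; distances 3 and 3 yield 18.
    have h5 : T.dist r y = 4 ∨ T.dist r x = 4 ∨ (T.dist r x = 3 ∧ T.dist r y = 3) := by omega
    rcases h5 with h | h | ⟨h, h'⟩
    · have e1 : T.eccMatrix r y = 4 := by exact_mod_cast entry (k := 4) h (by omega)
      have e2 : T.eccMatrix r b = 3 := by exact_mod_cast entry (k := 3) (by omega) (by omega)
      have e3 : T.eccMatrix r c = 2 := by exact_mod_cast entry (k := 2) (by omega) (by omega)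
      rw [e1, e2, e3]
      nlinarith
    · have e1 : T.eccMatrix r x = 4 := by exact_mod_cast entry (k := 4) h (by omega)
      have e2 : T.eccMatrix r a = 3 := by exact_mod_cast entry (k := 3) (by omega) (by omega)
      have e3 : T.eccMatrix r c = 2 := by exact_mod_cast entry (k := 2) (by omega) (by omega)
      rw [e1, e2, e3]
      nlinarith
    · have e1 : T.eccMatrix r x = 3 := by exact_mod_cast entry (k := 3) h (by omega)
      have e2 : T.eccMatrix r y = 3 := by exact_mod_cast entry (k := 3) h' (by omega)
      rw [e1, e2]
      nlinarith [sq_nonneg ((T.eccMatrix r a + T.eccMatrix r b) / 2), sq_nonneg (T.eccMatrix r c)]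

end SimpleGraph

/-! ### Double stars and their energies. -/

namespace SimpleGraph

variable {V : Type*}

/-- A labelling of the vertices of a graph by those of the path on four vertices that exhibits the
graph as a double star: the labels `1` and `2` belong to the centres, and the labels `0` and `3` to
their `a`, respectively `b`, pendant vertices. -/
structure IsDoubleStarLabelling [Fintype V] (T : SimpleGraph V) (t : V → Fin 4) (a b : ℕ) :
    Prop where
  adj_iff : ∀ u v, T.Adj u v ↔ (pathGraph 4).Adj (t u) (t v)
  card_fiber : ∀ i, Fintype.card {v // t v = i} = ![a, 1, 1, b] i
  left_pos : 0 < a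
  right_pos : 0 < b

namespace IsDoubleStarLabelling

variable [Fintype V] {T : SimpleGraph V} {t : V → Fin 4} {a b : ℕ}

theorem adj_iff' (h : T.IsDoubleStarLabelling t a b) (u v : V) :
    T.Adj u v ↔ (t u).val + 1 = (t v).val ∨ (t v).val + 1 = (t u).val := by
  rw [h.adj_iff, pathGraph_adj]

theorem exists_label (h : T.IsDoubleStarLabelling t a b) (i : Fin 4) : ∃ v, t v = i := by
  have h1 := h.card_fiber i
  have h2 : 0 < Fintype.card {v // t v = i} := by
    rw [h1]
    have := h.left_pos
    have := h.right_pos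
    fin_cases i <;> simp <;> omega
  obtain ⟨v⟩ := Fintype.card_pos_iff.mp h2
  exact ⟨v, v.2⟩

theorem eq_of_label_one (h : T.IsDoubleStarLabelling t a b) {u v : V} (hu : t u = 1)
    (hv : t v = 1) : u = v := by
  have := Fintype.card_le_one_iff.mp (h.card_fiber 1).le ⟨u, hu⟩ ⟨v, hv⟩
  simpa using this

theorem eq_of_label_two (h : T.IsDoubleStarLabelling t a b) {u v : V} (hu : t u = 2)
    (hv : t v = 2) : u = v := by
  have := Fintype.card_le_one_iff.mp (h.card_fiber 2).le ⟨u, hu⟩ ⟨v, hv⟩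
  simpa using this

theorem card_eq (h : T.IsDoubleStarLabelling t a b) : Fintype.card V = a + b + 2 := by
  rw [← Fintype.card_congr (Equiv.sigmaFiberEquiv t), Fintype.card_sigma, Fin.sum_univ_four]
  simp only [h.card_fiber]
  simp
  omega

theorem label_cases {W : Type*} (t : W → Fin 4) (u : W) : t u = 0 ∨ t u = 1 ∨ t u = 2 ∨ t u = 3 := by
  generalize t u = i
  fin_cases i <;> simp

theorem dist_center (h : T.IsDoubleStarLabelling t a b) (hT : T.Connected) {c₁ c₂ : V}
    (h1 : t c₁ = 1) (h2 : t c₂ = 2) (u : V) :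
    (t u = 0 ∧ T.dist u c₁ = 1 ∧ T.dist u c₂ = 2) ∨ (u = c₁ ∧ T.dist u c₁ = 0 ∧ T.dist u c₂ = 1) ∨
      (u = c₂ ∧ T.dist u c₁ = 1 ∧ T.dist u c₂ = 0) ∨
      (t u = 3 ∧ T.dist u c₁ = 2 ∧ T.dist u c₂ = 1) := by
  have h12 : T.dist c₁ c₂ = 1 := dist_eq_one_iff_adj.mpr (by rw [h.adj_iff', h1, h2]; decide)
  have h21 := T.dist_comm (u := c₁) (v := c₂)
  rcases label_cases t u with hu | hu | hu | hu
  · have e1 : T.dist u c₁ = 1 := dist_eq_one_iff_adj.mpr (by rw [h.adj_iff', h1, hu]; decide)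
    have e2 := hT.one_lt_dist_of_ne_of_not_adj (u := u) (v := c₂)
      (by rintro rfl; rw [hu] at h2; exact absurd h2 (by decide))
      (by rw [h.adj_iff', h2, hu]; decide)
    have e3 := hT.dist_triangle (u := u) (v := c₁) (w := c₂)
    exact Or.inl ⟨hu, e1, by omega⟩
  · obtain rfl := h.eq_of_label_one hu h1
    exact Or.inr (Or.inl ⟨rfl, by simp, h12⟩)
  · obtain rfl := h.eq_of_label_two hu h2
    exact Or.inr (Or.inr (Or.inl ⟨rfl, by omega, by simp⟩))
  · have e1 : T.dist u c₂ = 1 := dist_eq_one_iff_adj.mpr (by rw [h.adj_iff', h2, hu]; decide)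
    have e2 := hT.one_lt_dist_of_ne_of_not_adj (u := u) (v := c₁)
      (by rintro rfl; rw [hu] at h1; exact absurd h1 (by decide))
      (by rw [h.adj_iff', h1, hu]; decide)
    have e3 := hT.dist_triangle (u := u) (v := c₂) (w := c₁)
    exact Or.inr (Or.inr (Or.inr ⟨hu, by omega, e1⟩))

theorem dist_leaves (h : T.IsDoubleStarLabelling t a b) (hT : T.Connected) {u v : V}
    (hu : t u = 0) (hv : t v = 3) : T.dist u v = 3 := by
  obtain ⟨c₁, h1⟩ := h.exists_label 1
  obtain ⟨c₂, h2⟩ := h.exists_label 2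
  have key : T.dist u v ≤ 3 := by
    have := h.dist_center hT h1 h2 u
    have := h.dist_center hT h1 h2 v
    have := T.dist_comm (u := v) (v := c₁)
    have := hT.dist_triangle (u := u) (v := c₁) (w := v)
    omega
  have hne : u ≠ v := by
    rintro rfl
    rw [hu] at hv
    exact absurd hv (by decide)
  have h3 := hT.one_lt_dist_of_ne_of_not_adj hne (by rw [h.adj_iff', hu, hv]; decide)
  have h4 : T.dist u v ≠ 2 := by
    intro h4
    obtain ⟨w, huw, hw⟩ := hT.exists_adj_dist_eq (k := 1) h4
    rw [dist_eq_one_iff_adj, h.adj_iff'] at hw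
    rw [h.adj_iff'] at huw
    rw [hu] at huw
    rw [hv] at hw
    simp at huw hw
    omega
  omega

/-- Leaves have eccentricity 3 and centres 2, so only leaves on opposite sides (3) and leaves with
the opposite centre (2) give nonzero entries. The support is a path of classes: second centre, first
leaves, second leaves, first centre; the permutation of labels puts them in this order. -/
theorem eccMatrix_eq (h : T.IsDoubleStarLabelling t a b) (hT : T.Connected) :
    T.eccMatrix = (Matrix.weightedPath 2 3 2).submatrix (![1, 3, 0, 2] ∘ t) (![1, 3, 0, 2] ∘ t) := by
  obtain ⟨c₁, h1⟩ := h.exists_label 1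
  obtain ⟨c₂, h2⟩ := h.exists_label 2
  obtain ⟨x, hx⟩ := h.exists_label 0
  obtain ⟨y, hy⟩ := h.exists_label 3
  have hdc := h.dist_center hT h1 h2
  have hub : ∀ u v, T.dist u v ≤ T.dist u c₁ + T.dist v c₁ ∧
      T.dist u v ≤ T.dist u c₂ + T.dist v c₂ := fun u v => by
    have := T.dist_comm (u := v) (v := c₁)
    have := T.dist_comm (u := v) (v := c₂)
    have := hT.dist_triangle (u := u) (v := c₁) (w := v)
    have := hT.dist_triangle (u := u) (v := c₂) (w := v)
    omega
  have e0 : ∀ {u}, t u = 0 → T.eccent u = (3 : ℕ) := fun {u} hu =>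
    hT.eccent_eq (fun v => by
      have := hub u v
      rcases hdc v with hv | hv | hv | hv
      · rcases hdc u with hu' | hu' | hu' | hu' <;> omega
      · rcases hdc u with hu' | hu' | hu' | hu' <;> omega
      · rcases hdc u with hu' | hu' | hu' | hu' <;> omega
      · exact (h.dist_leaves hT hu hv.1).le) (h.dist_leaves hT hu hy)
  have e3 : ∀ {u}, t u = 3 → T.eccent u = (3 : ℕ) := fun {u} hu =>
    hT.eccent_eq (fun v => by
      rcases hdc v with hv | hv | hv | hv
      · rw [T.dist_comm]
        exact (h.dist_leaves hT hv.1 hu).le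
      · have := hub u v
        rcases hdc u with hu' | hu' | hu' | hu' <;> omega
      · have := hub u v
        rcases hdc u with hu' | hu' | hu' | hu' <;> omega
      · have := hub u v
        rcases hdc u with hu' | hu' | hu' | hu' <;> omega)
      (by rw [T.dist_comm]; exact h.dist_leaves hT hx hu)
  have cx := hdc x
  have cy := hdc y
  rw [hx] at cx
  rw [hy] at cy
  have e1 : T.eccent c₁ = (2 : ℕ) := hT.eccent_eq (v := y)
    (fun v => by rw [T.dist_comm]; rcases hdc v with hv | hv | hv | hv <;> omega)
    (by
      rw [T.dist_comm]
      rcases cy with hv | hv | hv | hv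
      · exact absurd hv.1 (by decide)
      · rw [hv.1, h1] at hy; exact absurd hy (by decide)
      · rw [hv.1, h2] at hy; exact absurd hy (by decide)
      · exact hv.2.1)
  have e2 : T.eccent c₂ = (2 : ℕ) := hT.eccent_eq (v := x)
    (fun v => by rw [T.dist_comm]; rcases hdc v with hv | hv | hv | hv <;> omega)
    (by
      rw [T.dist_comm]
      rcases cx with hv | hv | hv | hv
      · exact hv.2.2
      · rw [hv.1, h1] at hx; exact absurd hx (by decide)
      · rw [hv.1, h2] at hx; exact absurd hx (by decide)
      · exact absurd hv.1 (by decide))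
  ext u v
  rw [Matrix.submatrix_apply, Function.comp_apply, Function.comp_apply]
  have hb := hub u v
  have hcomm := T.dist_comm (u := u) (v := v)
  rcases hdc u with hu | hu | hu | hu <;> rcases hdc v with hv | hv | hv | hv
  · rw [eccMatrix_apply (e0 hu.1) (e0 hv.1), if_neg (by omega), hu.1, hv.1]
    simp [Matrix.weightedPath]
  · rw [hv.1, eccMatrix_apply (e0 hu.1) e1, if_neg (by omega), hu.1, h1]
    simp [Matrix.weightedPath]
  · rw [hv.1, eccMatrix_apply (e0 hu.1) e2, if_pos (by omega), hu.1, h2, hu.2.2]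
    simp [Matrix.weightedPath]
  · rw [eccMatrix_apply (e0 hu.1) (e3 hv.1), h.dist_leaves hT hu.1 hv.1, hu.1, hv.1]
    simp [Matrix.weightedPath]
  · rw [hu.1, eccMatrix_apply e1 (e0 hv.1), if_neg (by rw [T.dist_comm]; omega), hv.1, h1]
    simp [Matrix.weightedPath]
  · rw [hu.1, hv.1, eccMatrix_apply e1 e1, if_neg (by simp), h1]
    simp [Matrix.weightedPath]
  · rw [hu.1, hv.1, eccMatrix_apply e1 e2, if_neg (by rw [← hu.1]; omega), h1, h2]
    simp [Matrix.weightedPath]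
  · rw [hu.1, eccMatrix_apply e1 (e3 hv.1), T.dist_comm, if_pos (by omega), hv.1, h1, hv.2.1]
    simp [Matrix.weightedPath]
  · rw [hu.1, eccMatrix_apply e2 (e0 hv.1), T.dist_comm, if_pos (by omega), hv.1, h2, hv.2.2]
    simp [Matrix.weightedPath]
  · rw [hu.1, hv.1, eccMatrix_apply e2 e1, if_neg (by rw [← hu.1]; omega), h1, h2]
    simp [Matrix.weightedPath]
  · rw [hu.1, hv.1, eccMatrix_apply e2 e2, if_neg (by simp), h2]
    simp [Matrix.weightedPath]
  · rw [hu.1, eccMatrix_apply e2 (e3 hv.1), if_neg (by rw [T.dist_comm]; omega), hv.1, h2]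
    simp [Matrix.weightedPath]
  · rw [eccMatrix_apply (e3 hu.1) (e0 hv.1), T.dist_comm, h.dist_leaves hT hv.1 hu.1, hu.1, hv.1]
    simp [Matrix.weightedPath]
  · rw [hv.1, eccMatrix_apply (e3 hu.1) e1, if_pos (by omega), hu.1, h1, hu.2.1]
    simp [Matrix.weightedPath]
  · rw [hv.1, eccMatrix_apply (e3 hu.1) e2, if_neg (by omega), hu.1, h2]
    simp [Matrix.weightedPath]
  · rw [eccMatrix_apply (e3 hu.1) (e3 hv.1), if_neg (by omega), hu.1, hv.1]
    simp [Matrix.weightedPath]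

/-- In the complement, pendant edges of `T` become distance 2 and the central edge distance 3, while
every other distance is at most 1, below all eccentricities. The support is therefore `T` itself,
with no relabelling. -/
theorem eccMatrix_compl_eq (h : T.IsDoubleStarLabelling t a b) (hTc : Tᶜ.Connected) :
    Tᶜ.eccMatrix = (Matrix.weightedPath 2 3 2).submatrix t t := by
  obtain ⟨c₁, h1⟩ := h.exists_label 1
  obtain ⟨c₂, h2⟩ := h.exists_label 2
  obtain ⟨x, hx⟩ := h.exists_label 0
  obtain ⟨y, hy⟩ := h.exists_label 3
  have ne_label : ∀ {u v}, t u ≠ t v → u ≠ v := fun hn he => hn (he ▸ rfl)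
  have cadj : ∀ {u v}, t u ≠ t v →
      ¬((t u).val + 1 = (t v).val ∨ (t v).val + 1 = (t u).val) → Tᶜ.Adj u v := fun hn ha =>
    (compl_adj _ _ _).mpr ⟨ne_label hn, fun hadj => ha ((h.adj_iff' _ _).mp hadj)⟩
  have d01 : ∀ {u v}, t u = 0 → t v = 1 → Tᶜ.dist u v = 2 := fun {u v} hu hv =>
    dist_compl_of_adj (w := y) (by rw [h.adj_iff', hu, hv]; decide)
      (cadj (by rw [hu, hy]; decide) (by rw [hu, hy]; decide))
      (cadj (by rw [hv, hy]; decide) (by rw [hv, hy]; decide))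
  have d23 : ∀ {u v}, t u = 2 → t v = 3 → Tᶜ.dist u v = 2 := fun {u v} hu hv =>
    dist_compl_of_adj (w := x) (by rw [h.adj_iff', hu, hv]; decide)
      (cadj (by rw [hu, hx]; decide) (by rw [hu, hx]; decide))
      (cadj (by rw [hv, hx]; decide) (by rw [hv, hx]; decide))
  have d12 : ∀ {u v}, t u = 1 → t v = 2 → Tᶜ.dist u v = 3 := fun {u v} hu hv => by
    have hle := Tᶜ.dist_le (Walk.cons
      (cadj (u := u) (v := y) (by rw [hu, hy]; decide) (by rw [hu, hy]; decide)) (Walk.cons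
      (cadj (u := y) (v := x) (by rw [hy, hx]; decide) (by rw [hy, hx]; decide)) (Walk.cons
      (cadj (u := x) (v := v) (by rw [hx, hv]; decide) (by rw [hx, hv]; decide)) Walk.nil)))
    simp only [Walk.length_cons, Walk.length_nil] at hle
    have hgt := hTc.one_lt_dist_of_ne_of_not_adj (u := u) (v := v)
      (ne_label (by rw [hu, hv]; decide))
      (fun hc => ((compl_adj _ _ _).mp hc).2 (by rw [h.adj_iff', hu, hv]; decide))
    have hne : Tᶜ.dist u v ≠ 2 := by
      intro h4
      obtain ⟨w, huw, hw⟩ := hTc.exists_adj_dist_eq (k := 1) h4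
      rw [dist_eq_one_iff_adj, compl_adj, h.adj_iff', hv] at hw
      rw [compl_adj, h.adj_iff', hu] at huw
      rcases label_cases t w with h5 | h5 | h5 | h5
      · rw [h5] at huw
        exact huw.2 (by decide)
      · exact huw.1 (h.eq_of_label_one hu h5)
      · exact hw.1 (h.eq_of_label_two h5 hv)
      · rw [h5] at hw
        exact hw.2 (by decide)
    omega
  have hna : ∀ {u v}, ¬((t u).val + 1 = (t v).val ∨ (t v).val + 1 = (t u).val) →
      Tᶜ.dist u v ≤ 1 := fun {u v} ha => by
    rcases eq_or_ne u v with rfl | hne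
    · simp
    · exact (dist_compl_of_not_adj (fun hadj => ha ((h.adj_iff' _ _).mp hadj)) hne).le
  have e0 : ∀ {u}, t u = 0 → Tᶜ.eccent u = (2 : ℕ) := fun {u} hu =>
    hTc.eccent_eq (fun v => by
      rcases label_cases t v with hv | hv | hv | hv
      · exact (hna (by rw [hu, hv]; decide)).trans (by norm_num)
      · exact (d01 hu hv).le
      · exact (hna (by rw [hu, hv]; decide)).trans (by norm_num)
      · exact (hna (by rw [hu, hv]; decide)).trans (by norm_num)) (d01 hu h1)
  have e1 : ∀ {u}, t u = 1 → Tᶜ.eccent u = (3 : ℕ) := fun {u} hu =>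
    hTc.eccent_eq (fun v => by
      rcases label_cases t v with hv | hv | hv | hv
      · rw [Tᶜ.dist_comm]
        exact (d01 hv hu).le.trans (by norm_num)
      · exact (hna (by rw [hu, hv]; decide)).trans (by norm_num)
      · exact (d12 hu hv).le
      · exact (hna (by rw [hu, hv]; decide)).trans (by norm_num)) (d12 hu h2)
  have e2 : ∀ {u}, t u = 2 → Tᶜ.eccent u = (3 : ℕ) := fun {u} hu =>
    hTc.eccent_eq (fun v => by
      rcases label_cases t v with hv | hv | hv | hv
      · exact (hna (by rw [hu, hv]; decide)).trans (by norm_num)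
      · rw [Tᶜ.dist_comm]
        exact (d12 hv hu).le
      · exact (hna (by rw [hu, hv]; decide)).trans (by norm_num)
      · exact (d23 hu hv).le.trans (by norm_num)) (by rw [Tᶜ.dist_comm]; exact d12 h1 hu)
  have e3 : ∀ {u}, t u = 3 → Tᶜ.eccent u = (2 : ℕ) := fun {u} hu =>
    hTc.eccent_eq (fun v => by
      rcases label_cases t v with hv | hv | hv | hv
      · exact (hna (by rw [hu, hv]; decide)).trans (by norm_num)
      · exact (hna (by rw [hu, hv]; decide)).trans (by norm_num)
      · rw [Tᶜ.dist_comm]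
        exact (d23 hv hu).le
      · exact (hna (by rw [hu, hv]; decide)).trans (by norm_num))
      (by rw [Tᶜ.dist_comm]; exact d23 h2 hu)
  have zero : ∀ {u v : V} {k l : ℕ}, Tᶜ.eccent u = k → Tᶜ.eccent v = l → 1 < k → 1 < l →
      ¬((t u).val + 1 = (t v).val ∨ (t v).val + 1 = (t u).val) → Tᶜ.eccMatrix u v = 0 := by
    intro u v k l hk hl hk1 hl1 ha
    have := hna ha
    rw [eccMatrix_apply hk hl, if_neg (by omega)]
  have upper : ∀ u v, (t u).val ≤ (t v).val →
      Tᶜ.eccMatrix u v = Matrix.weightedPath 2 3 2 (t u) (t v) := by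
    intro u v huv
    rcases label_cases t u with hu | hu | hu | hu <;>
      rcases label_cases t v with hv | hv | hv | hv <;> rw [hu, hv] at huv ⊢
    · rw [zero (e0 hu) (e0 hv) (by norm_num) (by norm_num) (by rw [hu, hv]; decide)]
      simp [Matrix.weightedPath]
    · rw [eccMatrix_apply (e0 hu) (e1 hv), d01 hu hv]
      simp [Matrix.weightedPath]
    · rw [zero (e0 hu) (e2 hv) (by norm_num) (by norm_num) (by rw [hu, hv]; decide)]
      simp [Matrix.weightedPath]
    · rw [zero (e0 hu) (e3 hv) (by norm_num) (by norm_num) (by rw [hu, hv]; decide)]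
      simp [Matrix.weightedPath]
    · exact absurd huv (by decide)
    · rw [zero (e1 hu) (e1 hv) (by norm_num) (by norm_num) (by rw [hu, hv]; decide)]
      simp [Matrix.weightedPath]
    · rw [eccMatrix_apply (e1 hu) (e2 hv), d12 hu hv]
      simp [Matrix.weightedPath]
    · rw [zero (e1 hu) (e3 hv) (by norm_num) (by norm_num) (by rw [hu, hv]; decide)]
      simp [Matrix.weightedPath]
    · exact absurd huv (by decide)
    · exact absurd huv (by decide)
    · rw [zero (e2 hu) (e2 hv) (by norm_num) (by norm_num) (by rw [hu, hv]; decide)]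
      simp [Matrix.weightedPath]
    · rw [eccMatrix_apply (e2 hu) (e3 hv), d23 hu hv]
      simp [Matrix.weightedPath]
    · exact absurd huv (by decide)
    · exact absurd huv (by decide)
    · exact absurd huv (by decide)
    · rw [zero (e3 hu) (e3 hv) (by norm_num) (by norm_num) (by rw [hu, hv]; decide)]
      simp [Matrix.weightedPath]
  have wsymm : ∀ i j, Matrix.weightedPath 2 3 2 i j = Matrix.weightedPath 2 3 2 j i := by
    intro i j
    fin_cases i <;> fin_cases j <;> simp [Matrix.weightedPath]
  ext u v
  rw [Matrix.submatrix_apply]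
  rcases le_total (t u).val (t v).val with huv | huv
  · exact upper u v huv
  · rw [eccMatrix_comm, wsymm]
    exact upper v u huv

theorem eccEnergy_eq [DecidableEq V] (h : T.IsDoubleStarLabelling t a b) (hT : T.Connected) :
    T.eccEnergy = 2 * √(4 * (a + b : ℝ) + 9 * (a * b) + 8 * √(a * b : ℝ)) := by
  have ha : (0 : ℝ) < a := by exact_mod_cast h.left_pos
  have hb : (0 : ℝ) < b := by exact_mod_cast h.right_pos
  -- The inverse permutation, which turns the class sizes a, 1, 1, b into 1, a, b, 1.
  have hσ : ∀ i j : Fin 4, (![1, 3, 0, 2] : Fin 4 → Fin 4) i = j ↔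
      i = (![2, 0, 3, 1] : Fin 4 → Fin 4) j := by
    decide
  rw [eccEnergy_eq_traceNorm, T.eccMatrix_isHermitian.traceNorm_blowup_weightedPath
    (α := 2) (β := 3) (γ := 2) (N₀ := 1) (N₁ := a) (N₂ := b) (N₃ := 1) _ (h.eccMatrix_eq hT)
    ?_ (by norm_num) (by norm_num) (by norm_num) one_pos ha hb one_pos]
  · rw [show (1 : ℝ) * a * b * 1 = a * b by ring]
    congr 2
    ring
  · intro i
    have : Fintype.card {v // (![1, 3, 0, 2] ∘ t) v = i}
        = Fintype.card {v // t v = (![2, 0, 3, 1] : Fin 4 → Fin 4) i} :=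
      Fintype.card_congr (Equiv.subtypeEquivRight fun v => hσ (t v) i)
    rw [this, h.card_fiber]
    fin_cases i <;> simp

theorem eccEnergy_compl_eq [DecidableEq V] (h : T.IsDoubleStarLabelling t a b)
    (hTc : Tᶜ.Connected) :
    Tᶜ.eccEnergy = 2 * √(4 * (a + b : ℝ) + 9 + 8 * √(a * b : ℝ)) := by
  have ha : (0 : ℝ) < a := by exact_mod_cast h.left_pos
  have hb : (0 : ℝ) < b := by exact_mod_cast h.right_pos
  rw [eccEnergy_eq_traceNorm, Tᶜ.eccMatrix_isHermitian.traceNorm_blowup_weightedPath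
    (α := 2) (β := 3) (γ := 2) (N₀ := a) (N₁ := 1) (N₂ := 1) (N₃ := b) _ (h.eccMatrix_compl_eq hTc)
    ?_ (by norm_num) (by norm_num) (by norm_num) ha one_pos one_pos hb]
  · rw [show (a : ℝ) * 1 * 1 * b = a * b by ring]
    congr 2
    ring
  · intro i
    rw [h.card_fiber]
    fin_cases i <;> simp

theorem symm (h : T.IsDoubleStarLabelling t a b) :
    T.IsDoubleStarLabelling (Fin.rev ∘ t) b a where
  adj_iff u v := by
    rw [h.adj_iff', pathGraph_adj]
    simp only [Function.comp_apply, Fin.val_rev]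
    omega
  card_fiber i := by
    have : Fintype.card {v // (Fin.rev ∘ t) v = i} = Fintype.card {v // t v = Fin.rev i} :=
      Fintype.card_congr (Equiv.subtypeEquivRight fun v => Fin.rev_eq_iff)
    rw [this, h.card_fiber]
    fin_cases i <;> rfl
  left_pos := h.right_pos
  right_pos := h.left_pos

/-- Adjacency depends on labels alone, so any bijection matching the fibres is an isomorphism. -/
theorem nonempty_iso {W : Type*} [Fintype W] {S : SimpleGraph W} {s : W → Fin 4}
    (h : T.IsDoubleStarLabelling t a b) (h' : S.IsDoubleStarLabelling s a b) :
    Nonempty (T ≃g S) := by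
  have he : ∀ i, Nonempty ({v // t v = i} ≃ {w // s w = i}) := fun i =>
    Fintype.card_eq.mp (by rw [h.card_fiber, h'.card_fiber])
  let e := fun i => (he i).some
  have hmap : ∀ v, s (Equiv.ofFiberEquiv e v) = t v := fun v => Equiv.ofFiberEquiv_map e v
  exact ⟨⟨Equiv.ofFiberEquiv e, by
    intro u v
    rw [h.adj_iff, h'.adj_iff, hmap, hmap]⟩⟩

theorem of_iso {W : Type*} [Fintype W] {S : SimpleGraph W} {s : W → Fin 4}
    (h' : S.IsDoubleStarLabelling s a b) (φ : T ≃g S) :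
    T.IsDoubleStarLabelling (s ∘ φ) a b where
  adj_iff u v := by
    rw [Function.comp_apply, Function.comp_apply, ← h'.adj_iff, φ.map_adj_iff]
  card_fiber i := by
    rw [← h'.card_fiber]
    exact Fintype.card_congr (φ.toEquiv.subtypeEquiv fun v => Iff.rfl)
  left_pos := h'.left_pos
  right_pos := h'.right_pos

end IsDoubleStarLabelling

/-- The labelling of a `diamThreeTree` by the vertices of the path it is built on. -/
def diamThreeTreeLabel (a b : ℕ) : Fin 4 ⊕ (Fin a ⊕ Fin b) → Fin 4
  | Sum.inl i => i
  | Sum.inr (Sum.inl _) => 0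
  | Sum.inr (Sum.inr _) => 3

/-- The ends of the base path are leaves too, whence the shift by one. -/
theorem isDoubleStarLabelling_diamThreeTree (a b : ℕ) :
    (diamThreeTree a b).IsDoubleStarLabelling (diamThreeTreeLabel a b) (a + 1) (b + 1) where
  adj_iff u v := by
    simp only [diamThreeTree, fromRel_adj]
    rcases u with i | i | i <;> rcases v with j | j | j <;>
      simp only [diamThreeTreeLabel, pathGraph_adj]
    · simp only [ne_eq, Sum.inl.injEq]
      omega
    all_goals simp
    all_goals omega
  card_fiber i := by
    rw [Fintype.card_subtype, Finset.card_filter, Fintype.sum_sum_type, Fintype.sum_sum_type]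
    simp only [diamThreeTreeLabel]
    fin_cases i <;> simp [Fin.sum_univ_four, add_comm]
  left_pos := Nat.succ_pos a
  right_pos := Nat.succ_pos b

end SimpleGraph

/-! ### Numerical comparison of square roots. -/

namespace Real

/-- With m = n - 3, this says that the complement term of the bound exceeds its estimate 2√(n - 1)
by at most 21/10. -/
theorem sqrt_four_mul_add_le {m : ℝ} (hm : 2 ≤ m) :
    √(4 * m + 13 + 8 * √m) ≤ 2 * √(m + 2) + 21 / 10 := by
  have h1 : √m ≤ √(m + 2) := sqrt_le_sqrt (by linarith)
  have h2 : 2 ≤ √(m + 2) := le_sqrt_of_sq_le (by linarith)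
  have h3 := sq_sqrt (show 0 ≤ m + 2 by linarith)
  rw [sqrt_le_iff]
  exact ⟨by linarith, by nlinarith⟩

/-- Here the margin is below one tenth and the estimate of the tree term used for n ≥ 6 fails, so
decimal bounds are needed. -/
theorem sqrt_add_sqrt_lt_of_five {n : ℝ} (hn : n = 5) :
    √(13 * n - 35 + 8 * √(n - 3)) + √(4 * n + 1 + 8 * √(n - 3))
      < √13 + √(33 / 2 * n - 123 / 2) + 2 * √(n - 1) := by
  rw [hn]
  norm_num
  have h1 : √2 ≤ 1.41422 := sqrt_le_iff.mpr ⟨by norm_num, by norm_num⟩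
  have h2 : √(30 + 8 * √2) ≤ 6.4277 := sqrt_le_iff.mpr ⟨by norm_num, by norm_num at h1 ⊢; linarith⟩
  have h3 : √(21 + 8 * √2) ≤ 5.6847 := sqrt_le_iff.mpr ⟨by norm_num, by norm_num at h1 ⊢; linarith⟩
  have h4 : 3.605 ≤ √13 := le_sqrt_of_sq_le (by norm_num)
  have h5 : 4.582 ≤ √21 := le_sqrt_of_sq_le (by norm_num)
  have h6 : 2 ≤ √4 := le_sqrt_of_sq_le (by norm_num)
  norm_num at *
  linarith

theorem sqrt_add_sqrt_lt_of_six_le {n : ℝ} (hn : 6 ≤ n) :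
    √(13 * n - 35 + 8 * √(n - 3)) + √(4 * n + 1 + 8 * √(n - 3))
      < √13 + √(33 / 2 * n - 123 / 2) + 2 * √(n - 1) := by
  obtain ⟨m, rfl⟩ : ∃ m, n = m + 3 := ⟨n - 3, by ring⟩
  have h1 := sqrt_four_mul_add_le (m := m) (by linarith)
  have hs := sq_sqrt (show 0 ≤ m by linarith)
  have hs3 : 1.73 ≤ √m := le_sqrt_of_sq_le (by norm_num; linarith)
  have hq := sq_sqrt (show 0 ≤ 33 / 2 * m - 12 by linarith)
  have hqs : 7 / 2 * √m ≤ √(33 / 2 * m - 12) := le_sqrt_of_sq_le (by nlinarith)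
  -- The two excesses add up to 3/2 + 21/10 = 3.6, just below √13.
  have h2 : √(13 * m + 4 + 8 * √m) ≤ √(33 / 2 * m - 12) + 3 / 2 := by
    rw [sqrt_le_iff]
    refine ⟨by positivity, ?_⟩
    norm_num at hs3
    nlinarith
  have h13 : 3.605 ≤ √13 := le_sqrt_of_sq_le (by norm_num)
  rw [show 13 * (m + 3) - 35 + 8 * √(m + 3 - 3) = 13 * m + 4 + 8 * √m by ring_nf,
    show 4 * (m + 3) + 1 + 8 * √(m + 3 - 3) = 4 * m + 13 + 8 * √m by ring_nf,
    show 33 / 2 * (m + 3) - 123 / 2 = 33 / 2 * m - 12 by ring, show m + 3 - 1 = m + 2 by ring]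
  norm_num at h13
  linarith

theorem sqrt_add_sqrt_lt_five_add {n : ℝ} (hn : 6 ≤ n) :
    √(13 * n - 35 + 8 * √(n - 3)) + √(4 * n + 1 + 8 * √(n - 3))
      < 5 + √(16 * n - 71) + 2 * √(n - 1) := by
  obtain ⟨m, rfl⟩ : ∃ m, n = m + 3 := ⟨n - 3, by ring⟩
  have h1 := sqrt_four_mul_add_le (m := m) (by linarith)
  have hs := sq_sqrt (show 0 ≤ m by linarith)
  have hs3 : 1.73 ≤ √m := le_sqrt_of_sq_le (by norm_num; linarith)
  have hq := sq_sqrt (show 0 ≤ 16 * m - 23 by linarith)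
  have hqs : 14 / 5 * √m ≤ √(16 * m - 23) := le_sqrt_of_sq_le (by nlinarith)
  -- Here the excesses add up to 14/5 + 21/10 = 4.9 < 5.
  have h2 : √(13 * m + 4 + 8 * √m) ≤ √(16 * m - 23) + 14 / 5 := by
    rw [sqrt_le_iff]
    refine ⟨by positivity, ?_⟩
    norm_num at hs3
    nlinarith
  rw [show 13 * (m + 3) - 35 + 8 * √(m + 3 - 3) = 13 * m + 4 + 8 * √m by ring_nf,
    show 4 * (m + 3) + 1 + 8 * √(m + 3 - 3) = 4 * m + 13 + 8 * √m by ring_nf,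
    show 16 * (m + 3) - 71 = 16 * m - 23 by ring, show m + 3 - 1 = m + 2 by ring]
  linarith

end Real

/-! ### Trees by diameter, and the final comparison. -/

namespace SimpleGraph

variable {V : Type*} {T : SimpleGraph V}

/-- Every vertex of a tree of diameter three is a centre or adjacent to just one of the two
centres. -/
theorem IsTree.dist_centers_of_diam_eq_three (hT : T.IsTree) {x y c₁ c₂ : V}
    (hd : ∀ u v, T.dist u v ≤ T.dist x y) (h3 : T.dist x y = 3) (h1 : T.dist x c₁ = 1)
    (h1' : T.dist c₁ y = 2) (h2 : T.dist x c₂ = 2) (h2' : T.dist c₂ y = 1) (u : V) :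
    u = c₁ ∨ u = c₂ ∨ (T.dist u c₁ = 1 ∧ T.dist u c₂ = 2) ∨
      (T.dist u c₁ = 2 ∧ T.dist u c₂ = 1) := by
  have h12 := hT.dist_between (x := x) (y := y) (z := c₁) (w := c₂) (by omega) (by omega) (by omega)
  obtain ⟨p, hp1, hp2, hp3⟩ := hT.exists_median x y u
  have hx := hd u x
  have hy := hd u y
  have hpx := T.dist_comm (u := p) (v := x)
  have hadj : T.Adj c₁ c₂ := dist_eq_one_iff_adj.mp (by omega)
  have hne := hT.dist_ne_of_adj u hadj
  have t1 := hT.connected.dist_triangle (u := u) (v := c₁) (w := c₂)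
  have t2 := hT.connected.dist_triangle (u := u) (v := c₂) (w := c₁)
  have hc := T.dist_comm (u := c₁) (v := c₂)
  have t3 := hT.connected.dist_triangle (u := u) (v := p) (w := c₁)
  have t4 := hT.connected.dist_triangle (u := u) (v := p) (w := c₂)
  have on : ∀ {w}, T.dist x w + T.dist w y = T.dist x y → T.dist x p = T.dist x w → p = w :=
    fun hw h => hT.eq_of_between hp3 hw h
  have hclose : T.dist u c₁ ≤ 1 ∨ T.dist u c₂ ≤ 1 := by
    have h : T.dist x p = 0 ∨ T.dist x p = 1 ∨ T.dist x p = 2 ∨ T.dist x p = 3 := by omega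
    rcases h with h | h | h | h
    · obtain rfl := hT.connected.dist_eq_zero_iff.mp h
      left
      omega
    · obtain rfl := on (w := c₁) (by omega) (by omega)
      rw [T.dist_self] at t3
      left
      omega
    · obtain rfl := on (w := c₂) (by omega) (by omega)
      rw [T.dist_self] at t4
      right
      omega
    · obtain rfl : p = y := hT.connected.dist_eq_zero_iff.mp (by omega)
      right
      have := T.dist_comm (u := p) (v := c₂)
      omega
  rcases Nat.eq_zero_or_pos (T.dist u c₁) with h | h
  · exact Or.inl (hT.connected.dist_eq_zero_iff.mp h)
  rcases Nat.eq_zero_or_pos (T.dist u c₂) with h' | h'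
  · exact Or.inr (Or.inl (hT.connected.dist_eq_zero_iff.mp h'))
  right; right
  omega

theorem IsTree.exists_isDoubleStarLabelling [Fintype V] [DecidableEq V] (hT : T.IsTree) {x y : V}
    (hd : ∀ u v, T.dist u v ≤ T.dist x y) (h3 : T.dist x y = 3) :
    ∃ t a b, T.IsDoubleStarLabelling t a b := by
  obtain ⟨c₁, h1, h1'⟩ := hT.connected.exists_between (x := x) (y := y) (k := 1) (by omega)
  obtain ⟨c₂, h2, h2'⟩ := hT.connected.exists_between (x := x) (y := y) (k := 2) (by omega)
  rw [h3] at h1' h2'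
  replace h1' : T.dist c₁ y = 2 := h1'
  replace h2' : T.dist c₂ y = 1 := h2'
  have h12 := hT.dist_between (x := x) (y := y) (z := c₁) (w := c₂) (by omega) (by omega) (by omega)
  have hdc := hT.dist_centers_of_diam_eq_three hd h3 h1 h1' h2 h2'
  have h12' : T.dist c₁ c₂ = 1 := by omega
  have h21 : T.dist c₂ c₁ = 1 := by rw [T.dist_comm]; exact h12'
  have hadj : T.Adj c₁ c₂ := dist_eq_one_iff_adj.mp h12'
  let t : V → Fin 4 := fun u => if u = c₁ then 1 else if u = c₂ then 2 else
    if T.dist u c₁ = 1 then 0 else 3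
  have cases : ∀ u, (t u = 1 ∧ u = c₁) ∨ (t u = 2 ∧ u = c₂) ∨
      (t u = 0 ∧ T.dist u c₁ = 1 ∧ T.dist u c₂ = 2) ∨
      (t u = 3 ∧ T.dist u c₁ = 2 ∧ T.dist u c₂ = 1) := by
    intro u
    by_cases hu1 : u = c₁
    · exact Or.inl ⟨by simp [t, hu1], hu1⟩
    by_cases hu2 : u = c₂
    · exact Or.inr (Or.inl ⟨by simp [t, hu2, hadj.ne.symm], hu2⟩)
    right; right
    rcases hdc u with h | h | h | h
    · exact absurd h hu1
    · exact absurd h hu2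
    · exact Or.inl ⟨by simp [t, hu1, hu2, dist_eq_one_iff_adj.mp h.1], h⟩
    · exact Or.inr ⟨by simp only [t, hu1, hu2, h.1, if_false]; rfl, h⟩
  have cross : ∀ {u v}, T.dist u c₁ = 1 → T.dist u c₂ = 2 → T.dist v c₁ = 2 → T.dist v c₂ = 1 →
      ¬T.Adj u v := by
    intro u v hu1 hu2 hv1 hv2 huv
    have e1 := dist_eq_one_iff_adj.mpr huv
    have e2 := T.dist_comm (u := u) (v := c₁)
    have e3 := T.dist_comm (u := v) (v := c₁)
    have e4 := T.dist_comm (u := v) (v := c₂)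
    have : u = c₂ := hT.eq_of_between (x := c₁) (y := v) (by omega) (by omega) (by omega)
    rw [this, T.dist_self] at hu2
    omega
  have same : ∀ {u v c}, T.dist u c = T.dist v c → ¬T.Adj u v := by
    intro u v c huv h
    refine hT.dist_ne_of_adj c h ?_
    rw [T.dist_comm, huv, T.dist_comm]
  have adj_val : ∀ u v, T.Adj u v ↔ (t u).val + 1 = (t v).val ∨ (t v).val + 1 = (t u).val := by
    intro u v
    rcases cases u with ⟨hu, hu'⟩ | ⟨hu, hu'⟩ | ⟨hu, hu'⟩ | ⟨hu, hu'⟩ <;>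
      rcases cases v with ⟨hv, hv'⟩ | ⟨hv, hv'⟩ | ⟨hv, hv'⟩ | ⟨hv, hv'⟩ <;> rw [hu, hv]
    · rw [hu', hv']; simp
    · rw [hu', hv']; simp [hadj]
    · rw [hu', T.adj_comm]; simp [dist_eq_one_iff_adj.mp hv'.1]
    · rw [hu', T.adj_comm, ← dist_eq_one_iff_adj, hv'.1]; simp
    · rw [hu', hv']; simp [hadj.symm]
    · rw [hu', hv']; simp
    · rw [hu', T.adj_comm, ← dist_eq_one_iff_adj, hv'.2]; simp
    · rw [hu', T.adj_comm]; simp [dist_eq_one_iff_adj.mp hv'.2]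
    · rw [hv']; simp [dist_eq_one_iff_adj.mp hu'.1]
    · rw [hv', ← dist_eq_one_iff_adj, hu'.2]; simp
    · simp [same (hu'.1.trans hv'.1.symm)]
    · simp [cross hu'.1 hu'.2 hv'.1 hv'.2]
    · rw [hv', ← dist_eq_one_iff_adj, hu'.1]; simp
    · rw [hv']; simp [dist_eq_one_iff_adj.mp hu'.2]
    · rw [T.adj_comm]; simp [cross hv'.1 hv'.2 hu'.1 hu'.2]
    · simp [same (hu'.1.trans hv'.1.symm)]
  have t1 : t c₁ = 1 := by simp [t]
  have t2 : t c₂ = 2 := by simp [t, hadj.ne.symm]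
  have tx : t x = 0 := by
    have hx1 : x ≠ c₁ := by rintro rfl; simp at h1
    have hx2 : x ≠ c₂ := by rintro rfl; simp at h2
    simp [t, hx1, hx2, dist_eq_one_iff_adj.mp h1]
  have ty : t y = 3 := by
    have hc := T.dist_comm (u := y) (v := c₁)
    have hy1 : y ≠ c₁ := by rintro rfl; simp at h1'
    have hy2 : y ≠ c₂ := by rintro rfl; simp at h2'
    have : T.dist y c₁ ≠ 1 := by omega
    simp only [t, hy1, hy2, this, if_false]
  refine ⟨t, Fintype.card {v // t v = 0}, Fintype.card {v // t v = 3}, ⟨?_, ?_, ?_, ?_⟩⟩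
  · intro u v
    rw [adj_val, pathGraph_adj]
  · intro i
    have card_one : ∀ {i : Fin 4} {c : V}, t c = i → (∀ u, t u = i → u = c) →
        Fintype.card {v // t v = i} = 1 := fun {i c} hc hu =>
      Fintype.card_eq_one_iff.mpr ⟨⟨c, hc⟩, fun u => Subtype.ext (hu _ u.2)⟩
    have i1 := card_one t1 fun u hu => by
      rcases cases u with h | h | h | h
      · exact h.2
      all_goals rw [hu] at h; exact absurd h.1 (by decide)
    have i2 := card_one t2 fun u hu => by
      rcases cases u with h | h | h | h
      · rw [hu] at h; exact absurd h.1 (by decide)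
      · exact h.2
      all_goals rw [hu] at h; exact absurd h.1 (by decide)
    fin_cases i
    · rfl
    · exact i1
    · exact i2
    · rfl
  · exact Fintype.card_pos_iff.mpr ⟨⟨x, tx⟩⟩
  · exact Fintype.card_pos_iff.mpr ⟨⟨y, ty⟩⟩

/-- A tree on at least three vertices with connected complement has diameter at least three. -/
theorem IsTree.three_le_diam_of_connected_compl [Fintype V] (hT : T.IsTree) (hTc : Tᶜ.Connected)
    (hV : 3 ≤ Fintype.card V) {x y : V} (hd : ∀ u v, T.dist u v ≤ T.dist x y) :
    3 ≤ T.dist x y := by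
  classical
  -- Such a vertex is isolated in the complement. For diameter at most 1 it would be `x`, for
  -- diameter 2 the midpoint of a diametral path.
  have not_universal : ∀ c : V, ¬∀ u, u ≠ c → T.Adj c u := by
    intro c hc
    have : Nontrivial V := Fintype.one_lt_card_iff_nontrivial.mp (by omega)
    obtain ⟨w, hw⟩ := exists_ne c
    obtain ⟨k, hk⟩ : ∃ k, Tᶜ.dist c w = k + 1 :=
      Nat.exists_eq_succ_of_ne_zero (hTc.pos_dist_of_ne hw.symm).ne'
    obtain ⟨z, hz, -⟩ := hTc.exists_adj_dist_eq hk
    exact ((compl_adj _ _ _).mp hz).2 (hc z hz.ne')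
  by_contra hlt
  have h : T.dist x y ≤ 1 ∨ T.dist x y = 2 := by omega
  rcases h with h | h
  · refine not_universal x fun u hu => dist_eq_one_iff_adj.mp ?_
    have := hd x u
    have := hT.connected.pos_dist_of_ne hu.symm
    omega
  · obtain ⟨c, hc, hc'⟩ := hT.connected.exists_between (x := x) (y := y) (k := 1) (by omega)
    refine not_universal c fun u hu => dist_eq_one_iff_adj.mp ?_
    obtain ⟨p, hp1, hp2, hp3⟩ := hT.exists_median x y u
    have hpos := hT.connected.pos_dist_of_ne hu
    have hx := hd u x
    have hy := hd u y
    have hpx := T.dist_comm (u := p) (v := x)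
    have hcu := T.dist_comm (u := c) (v := u)
    have t3 := hT.connected.dist_triangle (u := u) (v := p) (w := c)
    have h4 : T.dist x p = 0 ∨ T.dist x p = 1 ∨ T.dist x p = 2 := by omega
    rcases h4 with h4 | h4 | h4
    · obtain rfl := hT.connected.dist_eq_zero_iff.mp h4
      omega
    · obtain rfl : p = c := hT.eq_of_between hp3 (by omega) (by omega)
      rw [T.dist_self] at t3
      omega
    · obtain rfl : p = y := hT.connected.dist_eq_zero_iff.mp (by omega)
      have := T.dist_comm (u := p) (v := c)
      omega

theorem Connected.dist_lt_card [Fintype V] (hG : T.Connected) (x y : V) :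
    T.dist x y < Fintype.card V := by
  obtain ⟨p, hp, hl⟩ := hG.exists_path_of_dist x y
  rw [← hl]
  exact hp.length_lt

/-- Eliminating a + b = n - 2 leaves a function of the product ab that is visibly increasing. -/
theorem IsDoubleStarLabelling.eccEnergy_add_eq [Fintype V] [DecidableEq V] {t : V → Fin 4}
    {a b : ℕ} (h : T.IsDoubleStarLabelling t a b) (hT : T.Connected) (hTc : Tᶜ.Connected) {n : ℕ}
    (hV : Fintype.card V = n) :
    T.eccEnergy + Tᶜ.eccEnergy =
      2 * (√(4 * (n : ℝ) - 8 + 9 * (a * b : ℝ) + 8 * √(a * b : ℝ))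
        + √(4 * (n : ℝ) + 1 + 8 * √(a * b : ℝ))) := by
  have hn : (n : ℝ) = a + b + 2 := by
    rw [← hV, h.card_eq]
    push_cast
    ring
  rw [h.eccEnergy_eq hT, h.eccEnergy_compl_eq hTc, hn, mul_add]
  ring_nf

theorem eccEnergy_add_eq_of_iso [Fintype V] [DecidableEq V] {n : ℕ} (hn : 4 ≤ n)
    (hV : Fintype.card V = n) (hT : T.Connected) (hTc : Tᶜ.Connected)
    (φ : T ≃g diamThreeTree 0 (n - 4)) :
    T.eccEnergy + Tᶜ.eccEnergy = 2 * (√(13 * (n : ℝ) - 35 + 8 * √((n : ℝ) - 3))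
      + √(4 * (n : ℝ) + 1 + 8 * √((n : ℝ) - 3))) := by
  have h := (isDoubleStarLabelling_diamThreeTree 0 (n - 4)).of_iso φ
  rw [h.eccEnergy_add_eq hT hTc hV]
  have : ((n - 4 + 1 : ℕ) : ℝ) = (n : ℝ) - 3 := by
    push_cast [Nat.cast_sub hn]
    ring
  rw [this]
  norm_num
  ring_nf

/-- The sum of the energies of a double star and its complement is least when one of the centres
has a single pendant vertex. -/
theorem IsDoubleStarLabelling.le_eccEnergy_add [Fintype V] [DecidableEq V] {t : V → Fin 4}
    {a b : ℕ} (h : T.IsDoubleStarLabelling t a b) (hT : T.Connected) (hTc : Tᶜ.Connected) {n : ℕ}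
    (hn : 4 ≤ n) (hV : Fintype.card V = n) :
    2 * (√(13 * (n : ℝ) - 35 + 8 * √((n : ℝ) - 3)) + √(4 * (n : ℝ) + 1 + 8 * √((n : ℝ) - 3)))
        ≤ T.eccEnergy + Tᶜ.eccEnergy ∧
    (T.eccEnergy + Tᶜ.eccEnergy
        = 2 * (√(13 * (n : ℝ) - 35 + 8 * √((n : ℝ) - 3))
            + √(4 * (n : ℝ) + 1 + 8 * √((n : ℝ) - 3))) →
      Nonempty (T ≃g diamThreeTree 0 (n - 4))) := by
  have hnab : n = a + b + 2 := by rw [← hV, h.card_eq]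
  have ha : (1 : ℝ) ≤ a := by exact_mod_cast h.left_pos
  have hb : (1 : ℝ) ≤ b := by exact_mod_cast h.right_pos
  have hnr : (n : ℝ) = a + b + 2 := by rw [hnab]; push_cast; ring
  have hn4 : (4 : ℝ) ≤ n := by exact_mod_cast hn
  have hab : (n : ℝ) - 3 ≤ a * b := by nlinarith
  have hs : √((n : ℝ) - 3) ≤ √(a * b : ℝ) := Real.sqrt_le_sqrt hab
  have hs0 := Real.sqrt_nonneg ((n : ℝ) - 3)
  have e1 : √(13 * (n : ℝ) - 35 + 8 * √((n : ℝ) - 3))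
      ≤ √(4 * (n : ℝ) - 8 + 9 * (a * b : ℝ) + 8 * √(a * b : ℝ)) :=
    Real.sqrt_le_sqrt (by linarith)
  have e2 : √(4 * (n : ℝ) + 1 + 8 * √((n : ℝ) - 3)) ≤ √(4 * (n : ℝ) + 1 + 8 * √(a * b : ℝ)) :=
    Real.sqrt_le_sqrt (by linarith)
  rw [h.eccEnergy_add_eq hT hTc hV]
  refine ⟨by linarith, fun heq => ?_⟩
  have e3 : (n : ℝ) - 3 = a * b := by
    refine hab.antisymm (not_lt.mp fun hlt => ?_)
    have : √(13 * (n : ℝ) - 35 + 8 * √((n : ℝ) - 3))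
        < √(4 * (n : ℝ) - 8 + 9 * (a * b : ℝ) + 8 * √(a * b : ℝ)) :=
      Real.sqrt_lt_sqrt (by linarith) (by linarith)
    linarith
  -- This product is ab - (n - 3), so equality leaves a single leaf at one centre; if it is the
  -- second, the labelling is reversed.
  have e4 : ((a : ℝ) - 1) * ((b : ℝ) - 1) = 0 := by
    rw [hnr] at e3
    linear_combination -e3
  have target := isDoubleStarLabelling_diamThreeTree 0 (n - 4)
  rcases mul_eq_zero.mp e4 with h1 | h1
  · obtain rfl : a = 1 := by
      have : (a : ℝ) = (1 : ℕ) := by push_cast; linarith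
      exact_mod_cast this
    obtain rfl : b = n - 4 + 1 := by omega
    exact h.nonempty_iso target
  · obtain rfl : b = 1 := by
      have : (b : ℝ) = (1 : ℕ) := by push_cast; linarith
      exact_mod_cast this
    obtain rfl : a = n - 4 + 1 := by omega
    exact h.symm.nonempty_iso target

theorem IsTree.lt_eccEnergy_add_of_four_le_diam [Fintype V] [DecidableEq V] (hT : T.IsTree)
    (hTc : Tᶜ.Connected) {n : ℕ} (hV : Fintype.card V = n) {x y : V}
    (hd : ∀ u v, T.dist u v ≤ T.dist x y) (h4 : 4 ≤ T.dist x y) :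
    2 * (√(13 * (n : ℝ) - 35 + 8 * √((n : ℝ) - 3)) + √(4 * (n : ℝ) + 1 + 8 * √((n : ℝ) - 3)))
      < T.eccEnergy + Tᶜ.eccEnergy := by
  have hc := hT.four_mul_sqrt_le_eccEnergy_compl hTc h4
  have hlt := hT.connected.dist_lt_card x y
  rw [hV] at hc hlt
  rcases h4.eq_or_lt with h | h
  · have ht := hT.le_eccEnergy_of_diam_eq_four hd h.symm
    rw [hV] at ht
    rcases (show 5 ≤ n by omega).eq_or_lt with hn | hn
    · have := Real.sqrt_add_sqrt_lt_of_five (n := n) (by exact_mod_cast hn.symm)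
      linarith
    · have := Real.sqrt_add_sqrt_lt_of_six_le (n := n) (by exact_mod_cast hn)
      linarith
  · have ht := hT.le_eccEnergy_of_five_le_diam hd h
    rw [hV] at ht
    have := Real.sqrt_add_sqrt_lt_five_add (n := n) (by exact_mod_cast (show 6 ≤ n by omega))
    linarith

end SimpleGraph

theorem mainTheorem11 {V : Type*} [Fintype V] [DecidableEq V] (n : ℕ) (hn : 4 ≤ n)
    (hV : Fintype.card V = n) (T : SimpleGraph V) (hT : T.IsTree) (hTc : Tᶜ.Connected) :
    2 * (√(13 * (n : ℝ) - 35 + 8 * √((n : ℝ) - 3)) + √(4 * (n : ℝ) + 1 + 8 * √((n : ℝ) - 3)))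
        ≤ T.eccEnergy + Tᶜ.eccEnergy ∧
    (T.eccEnergy + Tᶜ.eccEnergy
        = 2 * (√(13 * (n : ℝ) - 35 + 8 * √((n : ℝ) - 3))
            + √(4 * (n : ℝ) + 1 + 8 * √((n : ℝ) - 3))) ↔
      Nonempty (T ≃g SimpleGraph.diamThreeTree 0 (n - 4))) := by
  have : Nonempty V := hT.connected.nonempty
  obtain ⟨⟨x, y⟩, hxy⟩ := Finite.exists_max fun p : V × V => T.dist p.1 p.2
  have hd : ∀ u v, T.dist u v ≤ T.dist x y := fun u v => hxy (u, v)
  have hiso : Nonempty (T ≃g SimpleGraph.diamThreeTree 0 (n - 4)) → _ := fun ⟨φ⟩ =>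
    SimpleGraph.eccEnergy_add_eq_of_iso hn hV hT.connected hTc φ
  rcases (hT.three_le_diam_of_connected_compl hTc (by omega) hd).eq_or_lt with h | h
  · obtain ⟨t, a, b, ht⟩ := hT.exists_isDoubleStarLabelling hd h.symm
    have key := ht.le_eccEnergy_add hT.connected hTc hn hV
    exact ⟨key.1, key.2, hiso⟩
  · have key := hT.lt_eccEnergy_add_of_four_le_diam hTc hV hd h
    exact ⟨key.le, fun he => absurd he key.ne', hiso⟩
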